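/- Let $K$ be an imaginary-quadratic field with ring of integers $\mathfrak{o}$, discriminant $d_K\notin\{-3,-4\}$ and non-trivial automorphism $\overline{\phantom{x}}$. Let $(V,h)$ be a hermitian space of odd dimension $n$ over $K$ (not necessarily definite), with unitary group $U(V)$ and special unitary group $SU(V)=\{\sigma\in U(V)\mid\det\sigma=1\}$. A lattice on $V$ is a finitely generated $\mathfrak{o}$-submodule of $V$ that spans $V$ over $K$; it can be written as $\mathfrak{a}_1x_1+\dots+\mathfrak{a}_nx_n$ with a basis $x_1,\dots,x_n$ of $V$ and fractional ideals $\mathfrak{a}_i$, and its Steinitz class is $\mathfrak{st}(L)=[\mathfrak{a}_1\cdots\mathfrak{a}_n]$ in the ideal class group of $K$. For a prime number $p$ let $V_p=V\otimes_{\mathbb{Q}}\mathbb{Q}_p$ with the extended form, over $K_p=K\otimes_{\mathbb{Q}}\mathbb{Q}_p$, and let $L_p=L\otimes_{\mathbb{Z}}\mathbb{Z}_p\subseteq V_p$. The genus $\operatorname{gen}(L)$ (resp. special genus $\operatorname{gen}^+(L)$) is the set of lattices $N$ on $V$ such that for every prime $p$ there is $\sigma\in U(V_p)$ (resp. $\sigma\in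 SU(V_p)$) with $\sigma(L_p)=N_p$. Let $L$ be a unimodular lattice on $V$, i.e. $L=\{x\in V\mid h(x,L)\subseteq\mathfrak{o}\}$. Then the special class number of $L$, that is the number of $SU(V)$-orbits of lattices in $\operatorname{gen}^+(L)$, is equal to the partial class number of $L$, that is the number of isometry classes ($U(V)$-orbits) of lattices in the partial genus $\{N\in\operatorname{gen}(L)\mid\mathfrak{st}(N)=\mathfrak{st}(L)\}$. -/

import Mathlib

open Module NumberField TensorProduct
open scoped nonZeroDivisors

noncomputable section

namespace HermLat

section Sesquilinear

variable {R : Type*} [CommRing R] {τ : R →+* R} {M : Type*} [AddCommGroup M] [Module R M]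

/-- A sesquilinear form, linear in the first argument, is hermitian if
`h x y = τ (h y x)`. -/
def IsHermitian (h : M →ₗ[R] M →ₛₗ[τ] R) : Prop :=
  ∀ x y, h x y = τ (h y x)

/-- The unitary group of a space with a sesquilinear form. -/
def unitaryGroup (h : M →ₗ[R] M →ₛₗ[τ] R) : Subgroup (M ≃ₗ[R] M) where
  carrier := {σ | ∀ x y, h (σ x) (σ y) = h x y}
  mul_mem' := by
    intro a b ha hb x y
    simp only [Set.mem_ofPred_eq] at ha hb
    rw [LinearEquiv.mul_apply, LinearEquiv.mul_apply, ha, hb]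
  one_mem' := fun _ _ => rfl
  inv_mem' := by
    intro a ha x y
    have h1 := ha (a⁻¹ x) (a⁻¹ y)
    rw [← LinearEquiv.mul_apply, ← LinearEquiv.mul_apply, mul_inv_cancel] at h1
    exact h1.symm

/-- The special unitary group: the isometries of determinant `1`. -/
def specialUnitaryGroup (h : M →ₗ[R] M →ₛₗ[τ] R) : Subgroup (M ≃ₗ[R] M) :=
  unitaryGroup h ⊓ (LinearEquiv.det : (M ≃ₗ[R] M) →* Rˣ).ker

end Sesquilinear

section BaseChange

variable {R : Type*} [CommRing R] {τ : R →+* R} {M : Type*} [AddCommGroup M] [Module R M]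
  {A : Type*} [CommRing A] [Algebra R A]

/-- The first step of the extension of scalars: for fixed `y`, the `A`-linear form
`a ⊗ x ↦ a * h x y` on `A ⊗ M`. -/
def extendLeft (h : M →ₗ[R] M →ₛₗ[τ] R) (y : M) : A ⊗[R] M →ₗ[A] A :=
  AlgebraTensorModule.lift
    { toFun := fun a => a • (Algebra.linearMap R A).comp (h.flip y)
      map_add' := fun a b => add_smul a b _
      map_smul' := fun a b => by simp [mul_smul] }

theorem extendLeft_tmul (h : M →ₗ[R] M →ₛₗ[τ] R) (y : M) (a : A) (x : M) :
    extendLeft h y (a ⊗ₜ[R] x) = a * algebraMap R A (h x y) := by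
  simp [extendLeft]

/-- The additive map `b ⊗ y ↦ (a ⊗ x ↦ a * τA b * h x y)`. -/
def extendAux (h : M →ₗ[R] M →ₛₗ[τ] R) (τA : A →+* A)
    (hτ : ∀ r, τA (algebraMap R A r) = algebraMap R A (τ r)) :
    A ⊗[R] M →+ (A ⊗[R] M →ₗ[A] A) :=
  TensorProduct.liftAddHom
    { toFun := fun b =>
        { toFun := fun y => τA b • extendLeft h y
          map_zero' := by
            ext x
            simp [extendLeft_tmul]
          map_add' := fun y z => by
            ext x
            simp [extendLeft_tmul, mul_add] }
      map_zero' := by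
        ext y x
        simp
      map_add' := fun b c => by
        ext y x
        simp [add_mul] }
    (fun r b y => by
      ext x
      simp [extendLeft_tmul, Algebra.smul_def, hτ]
      ring)

theorem extendAux_tmul (h : M →ₗ[R] M →ₛₗ[τ] R) (τA : A →+* A)
    (hτ : ∀ r, τA (algebraMap R A r) = algebraMap R A (τ r)) (b : A) (y : M) :
    extendAux h τA hτ (b ⊗ₜ[R] y) = τA b • extendLeft h y := rfl

/-- The extension of a sesquilinear form `h` on `M` to `A ⊗ M`, where `τA` is a ring
endomorphism of `A` that extends `τ`. It is determined by `extendForm_tmul`. -/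
def extendForm (h : M →ₗ[R] M →ₛₗ[τ] R) (τA : A →+* A)
    (hτ : ∀ r, τA (algebraMap R A r) = algebraMap R A (τ r)) :
    A ⊗[R] M →ₗ[A] A ⊗[R] M →ₛₗ[τA] A :=
  LinearMap.mk₂'ₛₗ (RingHom.id A) τA (fun u v => extendAux h τA hτ v u)
    (fun u u' v => map_add _ u u')
    (fun c u v => map_smul _ c u)
    (fun u v v' => by simp)
    (fun c u v => by
      induction v with
      | zero => simp
      | add v w hv hw => simpa [smul_add, mul_add] using congrArg₂ (· + ·) hv hw
      | tmul b y =>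
        rw [TensorProduct.smul_tmul', extendAux_tmul, extendAux_tmul]
        simp [mul_assoc])

theorem extendForm_tmul (h : M →ₗ[R] M →ₛₗ[τ] R) (τA : A →+* A)
    (hτ : ∀ r, τA (algebraMap R A r) = algebraMap R A (τ r)) (a b : A) (x y : M) :
    extendForm h τA hτ (a ⊗ₜ[R] x) (b ⊗ₜ[R] y) = a * τA b * algebraMap R A (h x y) := by
  change extendAux h τA hτ (b ⊗ₜ[R] y) (a ⊗ₜ[R] x) = _
  rw [extendAux_tmul, LinearMap.smul_apply, extendLeft_tmul, smul_eq_mul]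
  ring

end BaseChange

section Local

variable (K : Type*) [Field K] [NumberField K] (p : ℕ) [Fact p.Prime]

/-- The local algebra `K_p = K ⊗ ℚ_p` at a rational prime `p`. -/
abbrev LocalAlg : Type _ := K ⊗[ℚ] ℚ_[p]

/-- The local ring `𝔬_p`: the image of `𝓞 K ⊗ ℤ_p` in `K ⊗ ℚ_p`. -/
def localInt : Subalgebra ℤ (LocalAlg K p) :=
  (Algebra.TensorProduct.productMap
    (((Algebra.TensorProduct.includeLeft : K →ₐ[ℚ] LocalAlg K p).toRingHom.comp
      (algebraMap (𝓞 K) K)).toIntAlgHom)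
    (((Algebra.TensorProduct.includeRight : ℚ_[p] →ₐ[ℚ] LocalAlg K p).toRingHom.comp
      (algebraMap ℤ_[p] ℚ_[p])).toIntAlgHom)).range

variable {K}

/-- The extension of the conjugation of `K` to `K ⊗ ℚ_p`. -/
def localConj (conj : K ≃ₐ[ℚ] K) : LocalAlg K p →+* LocalAlg K p :=
  (Algebra.TensorProduct.map (conj : K →ₐ[ℚ] K) (AlgHom.id ℚ ℚ_[p])).toRingHom

theorem localConj_algebraMap (conj : K ≃ₐ[ℚ] K) (r : K) :
    localConj p conj (algebraMap K (LocalAlg K p) r) =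
      algebraMap K (LocalAlg K p) ((conj : K →+* K) r) := by
  simp [localConj, Algebra.TensorProduct.algebraMap_apply]

end Local

section Lattices

variable {K : Type*} [Field K] [NumberField K] {conj : K ≃ₐ[ℚ] K}
  {V : Type*} [AddCommGroup V] [Module K V] [Module (𝓞 K) V] [IsScalarTower (𝓞 K) K V]

/-- The localization `V_p` of `V`, written as `K_p ⊗_K V = V ⊗_ℚ ℚ_p`. -/
abbrev LocalSpace (K : Type*) [Field K] [NumberField K] (p : ℕ) [Fact p.Prime]
    (V : Type*) [AddCommGroup V] [Module K V] : Type _ :=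
  LocalAlg K p ⊗[K] V

/-- The `p`-adic extension of the form `h` to `V_p`. -/
def localForm (h : V →ₗ[K] V →ₛₗ[(conj : K →+* K)] K) (p : ℕ) [Fact p.Prime] :
    LocalSpace K p V →ₗ[LocalAlg K p] LocalSpace K p V →ₛₗ[localConj p conj] LocalAlg K p :=
  extendForm h (localConj p conj) (localConj_algebraMap p conj)

/-- The localization `L_p` of a lattice: the `𝔬_p`-submodule of `V_p` generated by `L`. -/
def localLattice (L : Submodule (𝓞 K) V) (p : ℕ) [Fact p.Prime] :
    Submodule (localInt K p) (LocalSpace K p V) :=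
  Submodule.span (localInt K p) ((fun x : V => (1 : LocalAlg K p) ⊗ₜ[K] x) '' (L : Set V))

/-- The dual `{x | h(x, L) ⊆ 𝓞 K}` of `L`. -/
def dual (h : V →ₗ[K] V →ₛₗ[(conj : K →+* K)] K) (L : Submodule (𝓞 K) V) :
    Submodule (𝓞 K) V where
  carrier := {x | ∀ y ∈ L, ∃ a : 𝓞 K, algebraMap (𝓞 K) K a = h x y}
  zero_mem' := fun y _ => ⟨0, by simp⟩
  add_mem' := by
    intro x x' hx hx' y hy
    obtain ⟨a, ha⟩ := hx y hy
    obtain ⟨b, hb⟩ := hx' y hy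
    exact ⟨a + b, by rw [map_add, map_add, LinearMap.add_apply, ha, hb]⟩
  smul_mem' := by
    intro c x hx y hy
    obtain ⟨a, ha⟩ := hx y hy
    refine ⟨c * a, ?_⟩
    rw [map_mul, ha, ← algebraMap_smul K c x, map_smul, LinearMap.smul_apply, smul_eq_mul]

/-- `L` is a lattice on `V` that equals its dual. -/
def IsUnimodular (h : V →ₗ[K] V →ₛₗ[(conj : K →+* K)] K) (L : Submodule (𝓞 K) V) : Prop :=
  L.IsLattice K ∧ dual h L = L

/-- The isometry class of `L`: its images under `U(V)`. -/
def cls (h : V →ₗ[K] V →ₛₗ[(conj : K →+* K)] K) (L : Submodule (𝓞 K) V) :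
    Set (Submodule (𝓞 K) V) :=
  {N | ∃ σ ∈ unitaryGroup h, (N : Set V) = σ '' (L : Set V)}

/-- The special class of `L`: its images under `SU(V)`. -/
def specialCls (h : V →ₗ[K] V →ₛₗ[(conj : K →+* K)] K) (L : Submodule (𝓞 K) V) :
    Set (Submodule (𝓞 K) V) :=
  {N | ∃ σ ∈ specialUnitaryGroup h, (N : Set V) = σ '' (L : Set V)}

/-- The genus of `L`: the lattices on `V` that are isometric to `L` at all primes. -/
def genus (h : V →ₗ[K] V →ₛₗ[(conj : K →+* K)] K) (L : Submodule (𝓞 K) V) :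
    Set (Submodule (𝓞 K) V) :=
  {N | N.IsLattice K ∧ ∀ (p : ℕ) [Fact p.Prime], ∃ σ ∈ unitaryGroup (localForm h p),
    (localLattice N p : Set (LocalSpace K p V)) = σ '' (localLattice L p : Set _)}

/-- The special genus of `L`: as the genus, with local isometries of determinant `1`. -/
def specialGenus (h : V →ₗ[K] V →ₛₗ[(conj : K →+* K)] K) (L : Submodule (𝓞 K) V) :
    Set (Submodule (𝓞 K) V) :=
  {N | N.IsLattice K ∧ ∀ (p : ℕ) [Fact p.Prime], ∃ σ ∈ specialUnitaryGroup (localForm h p),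
    (localLattice N p : Set (LocalSpace K p V)) = σ '' (localLattice L p : Set _)}

/-- `L = 𝔞₁ x₁ + ⋯ + 𝔞ₙ xₙ` for a basis `x` of `V` and fractional ideals `𝔞ᵢ` whose
product has the class `c`. -/
def HasSteinitzClass (L : Submodule (𝓞 K) V) (c : ClassGroup (𝓞 K)) : Prop :=
  ∃ (x : Basis (Fin (finrank K V)) K V)
    (a : Fin (finrank K V) → (FractionalIdeal (𝓞 K)⁰ K)ˣ),
    (∀ v, v ∈ L ↔ ∀ i, x.repr v i ∈ (a i : FractionalIdeal (𝓞 K)⁰ K)) ∧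
      ClassGroup.mk K (∏ i, a i) = c

/-- The Steinitz class of a lattice on `V`: the class `c` with `HasSteinitzClass L c`
(it exists and is unique for a lattice `L` on `V`). -/
def steinitzClass (L : Submodule (𝓞 K) V) : ClassGroup (𝓞 K) :=
  Classical.epsilon (HasSteinitzClass L)

/-- The partial genus: the lattices in the genus of `L` with Steinitz class `c`. -/
def partialGenus (h : V →ₗ[K] V →ₛₗ[(conj : K →+* K)] K) (L : Submodule (𝓞 K) V)
    (c : ClassGroup (𝓞 K)) : Set (Submodule (𝓞 K) V) :=
  {N | N ∈ genus h L ∧ steinitzClass N = c}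

/-- The number of isometry classes of lattices in the partial genus, as a cardinal. -/
def partialClassNumber (h : V →ₗ[K] V →ₛₗ[(conj : K →+* K)] K) (L : Submodule (𝓞 K) V)
    (c : ClassGroup (𝓞 K)) : Cardinal :=
  Cardinal.mk (cls h '' partialGenus h L c)

/-- The number of special classes of lattices in the special genus, as a cardinal. -/
def specialClassNumber (h : V →ₗ[K] V →ₛₗ[(conj : K →+* K)] K) (L : Submodule (𝓞 K) V) :
    Cardinal :=
  Cardinal.mk (specialCls h '' specialGenus h L)

end Lattices

end HermLat

end

/-! Attach to a lattice `N` its determinant module `detIdeal b N`, the top exterior power of `N`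
seen inside `K`; its ideal class is the Steinitz class. An isometry multiplies this module by its
determinant.

Local isometries of determinant one fix the module at every prime, hence globally
(`detIdeal_eq_of_mem_specialGenus`). So the special genus lies in the partial genus, and the
equality of class numbers reduces to two claims.

Every class in the partial genus meets the special genus (`exists_isometric_mem_specialGenus`).
Equal Steinitz classes give `detIdeal b N = d • detIdeal b L`. Local isometries have determinants of
norm one that agree with `d` up to local units, so `d * conj d` is a unit of `𝓞 K`, positive in `ℂ`,
hence `1`. A global quasi-reflection of determinant `d⁻¹` moves `N`. At each `p` the remaining
determinant is a local unit of norm one, absorbed by a quasi-reflection preserving `L_p`. The latter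
needs a vector of `L` with norm prime to `p` (`exists_norm_not_dvd`). If there were none, `p` would
be `2` and the form on `L` modulo a prime above `2` would be alternating and nondegenerate,
impossible in odd rank.

Isometric lattices of the special genus are specially isometric
(`exists_special_isometry_of_mem_specialGenus`). The determinant of the isometry fixes the common
determinant module, so it is a unit of `𝓞 K`, that is `±1`, and `-1` has determinant `-1` in odd
dimension. -/

noncomputable section

namespace HermLat

open scoped Matrix Pointwise

/-! ### Units, conjugation and norms in imaginary-quadratic fields. -/

section ImaginaryQuadratic

variable {K : Type*} [Field K] [NumberField K]

theorem discr_neg_of_imaginaryQuadratic (hK : finrank ℚ K = 2) [IsTotallyComplex K] :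
    discr K < 0 := by
  have h1 := IsTotallyComplex.finrank K
  have h2 := sign_discr K
  have h3 : InfinitePlace.nrComplexPlaces K = 1 := by omega
  rw [h3, pow_one] at h2
  exact Int.sign_eq_neg_one_iff_neg.mp h2

/-- With `t`, `n` the trace and norm of `u`, the discriminant of `(1, u)` is `t² - 4n = m² * discr
K`. As `n = ±1`, the left side is at least `-4`, while `discr K ≤ -5`; so `m = 0` and the
characteristic polynomial of `u` is a square. -/
theorem unit_eq_one_or_neg_one (hK : finrank ℚ K = 2) [IsTotallyComplex K]
    (hd₃ : discr K ≠ -3) (hd₄ : discr K ≠ -4) (u : (𝓞 K)ˣ) : u = 1 ∨ u = -1 := by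
  have hD := discr_neg_of_imaginaryQuadratic hK
  have hD2 := abs_discr_gt_two (K := K) (by omega)
  rw [abs_of_neg hD] at hD2
  have hr : finrank ℤ (𝓞 K) = 2 := by rw [RingOfIntegers.rank, hK]
  let b : Basis (Fin 2) ℤ (𝓞 K) := finBasisOfFinrankEq ℤ (𝓞 K) hr
  have hb : Algebra.discr ℤ b = discr K := discr_eq_discr K b
  obtain ⟨M, hM⟩ : ∃ M : Matrix (Fin 2) (Fin 2) ℤ, M = Algebra.leftMulMatrix b (u : 𝓞 K) :=
    ⟨_, rfl⟩
  have hn : M.det = 1 ∨ M.det = -1 := by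
    have : M.det = Algebra.norm ℤ (u : 𝓞 K) := by
      rw [hM, Algebra.norm_eq_matrix_det b]
    rw [this]
    exact Int.isUnit_iff.mp (u.isUnit.map _)
  -- Up to sign, `P.det` is the index of `ℤ[u]` in `𝓞 K`, or `0` if `u` is rational.
  let P : Matrix (Fin 2) (Fin 2) ℤ := Matrix.of ![b.repr 1, b.repr u]
  have hP : P.map (algebraMap ℤ (𝓞 K)) *ᵥ b = ![1, (u : 𝓞 K)] := by
    ext i : 1
    have h0 := b.sum_repr 1
    have h1 := b.sum_repr (u : 𝓞 K)
    rw [Fin.sum_univ_two] at h0 h1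
    fin_cases i
    · simpa [Matrix.mulVec, dotProduct, P, Fin.sum_univ_two] using h0
    · simpa [Matrix.mulVec, dotProduct, P, Fin.sum_univ_two] using h1
  have hdisc : M.trace ^ 2 - 4 * M.det = P.det ^ 2 * discr K := by
    rw [← hb, ← Algebra.discr_of_matrix_mulVec, hP, Algebra.discr_def,
      Matrix.det_fin_two (Algebra.traceMatrix ℤ _)]
    simp only [Algebra.traceMatrix_apply, Algebra.traceForm_apply, Matrix.cons_val_zero,
      Matrix.cons_val_one, one_mul, mul_one]
    simp only [Algebra.trace_eq_matrix_trace b, map_mul, map_one, ← hM]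
    simp [Matrix.trace_fin_two, Matrix.det_fin_two, Matrix.mul_apply, Fin.sum_univ_two]
    ring
  have hquad : (u : 𝓞 K) ^ 2 - (M.trace : 𝓞 K) * u + (M.det : 𝓞 K) = 0 := by
    apply Algebra.leftMulMatrix_injective b
    rw [map_add, map_sub, map_mul, map_pow, map_zero, map_intCast, map_intCast, ← hM]
    ext i j
    rw [← Matrix.diagonal_intCast, ← Matrix.diagonal_intCast]
    fin_cases i <;> fin_cases j <;>
      simp [pow_two, Matrix.trace_fin_two, Matrix.det_fin_two, Matrix.mul_apply,
        Fin.sum_univ_two] <;> ring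
  have key : ∀ e : 𝓞 K, ((u : 𝓞 K) - e) ^ 2 = 0 → (u : 𝓞 K) = e := fun e he =>
    sub_eq_zero.mp (pow_eq_zero_iff two_ne_zero |>.mp he)
  generalize M.trace = t at *
  generalize M.det = n at *
  generalize P.det = m at *
  by_cases hm : m = 0
  · subst hm
    rcases hn with rfl | rfl
    · have : t ^ 2 = 2 ^ 2 := by linarith
      rcases sq_eq_sq_iff_eq_or_eq_neg.mp this with rfl | rfl
      · left
        ext1
        refine key 1 ?_
        rw [← hquad]
        push_cast
        ring
      · right
        ext1
        refine key (-1) ?_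
        rw [← hquad]
        push_cast
        ring
    · nlinarith [sq_nonneg t]
  · exfalso
    have hD5 : discr K ≤ -5 := by omega
    have hm1 : 1 ≤ m ^ 2 := by
      have := sq_pos_of_ne_zero hm
      omega
    rcases hn with rfl | rfl <;> nlinarith [sq_nonneg t]

theorem card_gal (hK : finrank ℚ K = 2) : Nat.card (K ≃ₐ[ℚ] K) = 2 := by
  have : Algebra.IsQuadraticExtension ℚ K := ⟨hK⟩
  rw [IsGalois.card_aut_eq_finrank, hK]

theorem eq_conj_of_ne_one (hK : finrank ℚ K = 2) {conj σ : K ≃ₐ[ℚ] K} (hconj : conj ≠ 1)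
    (hσ : σ ≠ 1) : σ = conj := by
  obtain ⟨x, y, -, h⟩ := Nat.card_eq_two_iff.mp (card_gal hK)
  have hmem : ∀ z : K ≃ₐ[ℚ] K, z = x ∨ z = y := fun z => by
    have : z ∈ ({x, y} : Set _) := h ▸ Set.mem_univ z
    simpa using this
  rcases hmem 1 with h1 | h1 <;> rcases hmem conj with h2 | h2 <;> rcases hmem σ with h3 | h3 <;>
    simp_all

/-- The complex conjugate of `φ` is `φ` composed with an automorphism of `K`, which is nontrivial
because `φ` is not real. -/
theorem embedding_conj (hK : finrank ℚ K = 2) [IsTotallyComplex K] {conj : K ≃ₐ[ℚ] K}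
    (hconj : conj ≠ 1) (φ : K →+* ℂ) (x : K) : φ (conj x) = star (φ x) := by
  have : Algebra.IsQuadraticExtension ℚ K := ⟨hK⟩
  obtain ⟨σ, hσ⟩ := ComplexEmbedding.exists_comp_symm_eq_of_comp_eq (k := ℚ) φ
    (ComplexEmbedding.conjugate φ) (Subsingleton.elim _ _)
  have hσ1 : σ.symm ≠ 1 := by
    intro h1
    have hr : ComplexEmbedding.IsReal φ := by
      rw [ComplexEmbedding.isReal_iff, ← hσ, h1]
      ext y
      rfl
    have h2 := IsTotallyComplex.isComplex (InfinitePlace.mk φ)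
    rw [InfinitePlace.isComplex_iff] at h2
    rcases InfinitePlace.embedding_mk_eq φ with h3 | h3
    · rw [h3] at h2
      exact h2 hr
    · rw [h3] at h2
      exact h2 (ComplexEmbedding.isReal_conjugate_iff.mpr hr)
  rw [← eq_conj_of_ne_one hK hconj hσ1]
  exact DFunLike.congr_fun hσ x

theorem exists_int_eq_of_conj_eq (hK : finrank ℚ K = 2) {conj : K ≃ₐ[ℚ] K}
    (hconj : conj ≠ 1) {a : 𝓞 K} (ha : conj a = (a : K)) : ∃ m : ℤ, (m : K) = (a : K) := by
  have : Algebra.IsQuadraticExtension ℚ K := ⟨hK⟩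
  have hmem : (a : K) ∈ (⊥ : IntermediateField ℚ K) := by
    rw [IsGalois.mem_bot_iff_fixed]
    intro f
    by_cases hf : f = 1
    · rw [hf]; rfl
    · rw [eq_conj_of_ne_one hK hconj hf, ha]
  obtain ⟨q, hq⟩ := IntermediateField.mem_bot.mp hmem
  have hqint : IsIntegral ℤ q := by
    rw [← isIntegral_algebraMap_iff (algebraMap ℚ K).injective, hq]
    exact a.isIntegral_coe
  obtain ⟨m, rfl⟩ := IsIntegrallyClosed.isIntegral_iff.mp hqint
  exact ⟨m, by rw [← hq]; simp⟩

/-- The unit is `±1`, and its image in `ℂ` is `|φ d|² ≥ 0`. -/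
theorem mul_conj_eq_one (hK : finrank ℚ K = 2) [IsTotallyComplex K]
    (hd₃ : discr K ≠ -3) (hd₄ : discr K ≠ -4) {conj : K ≃ₐ[ℚ] K} (hconj : conj ≠ 1) {d : K}
    {u : (𝓞 K)ˣ} (hu : ((u : 𝓞 K) : K) = d * conj d) : d * conj d = 1 := by
  obtain ⟨φ⟩ : Nonempty (K →+* ℂ) := inferInstance
  rcases unit_eq_one_or_neg_one hK hd₃ hd₄ u with rfl | rfl
  · simpa using hu.symm
  · exfalso
    have h1 : φ d * star (φ d) = -1 := by
      rw [← embedding_conj hK hconj, ← map_mul, ← hu]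
      simp
    have h2 : φ d * star (φ d) = ((Complex.normSq (φ d) : ℝ) : ℂ) := Complex.mul_conj _
    rw [h2] at h1
    have h3 : Complex.normSq (φ d) = -1 := by exact_mod_cast h1
    linarith [Complex.normSq_nonneg (φ d)]

end ImaginaryQuadratic

/-- In characteristic two, a symmetric matrix of odd size with zero diagonal is singular. -/
theorem det_eq_zero_of_isSymm_of_diag_eq_zero {ι R : Type*} [Fintype ι] [DecidableEq ι]
    [CommRing R] [CharP R 2] (hι : Odd (Fintype.card ι)) {A : Matrix ι ι R} (hA : A.IsSymm)
    (hdiag : ∀ i, A i i = 0) : A.det = 0 := by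
  rw [Matrix.det_apply]
  have hsign : ∀ (s : ℤˣ) (r : R), s • r = r := by
    intro s r
    rcases Int.units_eq_one_or s with rfl | rfl
    · simp
    · rw [Units.neg_smul, one_smul, CharTwo.neg_eq]
  simp only [hsign]
  -- By symmetry the terms of `σ` and `σ⁻¹` agree and cancel in characteristic two. If `σ = σ⁻¹`,
  -- then `σ` fixes a point of the odd set, and its term contains a diagonal entry.
  refine Finset.sum_involution (fun σ _ => σ⁻¹) ?_ ?_ (fun _ _ => Finset.mem_univ _)
    (fun σ _ => inv_inv σ)
  · intro σ _
    have : ∏ i, A (σ⁻¹ i) i = ∏ i, A (σ i) i := by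
      rw [← Equiv.prod_comp σ]
      refine Finset.prod_congr rfl fun i _ => ?_
      change A (σ.symm (σ i)) (σ i) = _
      rw [σ.symm_apply_apply, hA.apply]
    rw [this, CharTwo.add_self_eq_zero]
  · intro σ _ hne hσ
    apply hne
    have h2 : ¬ 2 ∣ Fintype.card ι := by
      rw [← even_iff_two_dvd, Nat.not_even_iff_odd]
      exact hι
    have : Fact (Nat.Prime 2) := ⟨Nat.prime_two⟩
    obtain ⟨i, hi⟩ := Equiv.Perm.exists_fixed_point_of_prime (p := 2) (n := 1) h2 (σ := σ) (by
      rw [pow_one, pow_two]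
      nth_rewrite 1 [← hσ]
      exact inv_mul_cancel σ)
    exact Finset.prod_eq_zero (Finset.mem_univ i) (by rw [hi, hdiag])

/-! ### Quasi-reflections. -/

section QuasiReflection

variable {R : Type*} [CommRing R] {τ : R →+* R} {M : Type*} [AddCommGroup M] [Module R M]

/-- If `h x x` is invertible and `u` is a unit of norm one, the isometry that multiplies `x` by `u`
and fixes the orthogonal complement of `x` has determinant `u`. -/
theorem exists_quasiReflection [Module.Free R M] [Module.Finite R M]
    (h : M →ₗ[R] M →ₛₗ[τ] R) {x : M} (hx : ∀ w, h x w = τ (h w x)) {c : R} (hc : c * h x x = 1)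
    (u : Rˣ) (hu : (u : R) * τ u = 1) :
    ∃ σ ∈ unitaryGroup h, LinearEquiv.det σ = u ∧
      (∀ v, σ v = v + ((u - 1 : R) * c * h v x) • x) ∧
      ∀ v, σ.symm v = v + (((u⁻¹ : Rˣ) - 1 : R) * c * h v x) • x := by
  let f : Dual R M := ((u - 1 : R) * c) • h.flip x
  have hf : ∀ v, f v = (u - 1 : R) * c * h v x := fun v => rfl
  have hfx : 1 + f x = u := by rw [hf, mul_assoc, hc]; ring
  have hunit : IsUnit (1 + f x) := hfx ▸ u.isUnit
  let σ := LinearEquiv.dilatransvection hunit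
  have hσ : ∀ v, σ v = v + ((u - 1 : R) * c * h v x) • x := fun v => by
    rw [← hf]; exact LinearEquiv.dilatransvection.apply
  have hcτ : τ c * h x x = 1 := by
    have := congrArg τ hc
    rwa [map_mul, ← hx, map_one] at this
  -- The norm `h x x` is fixed by `τ`, hence so is its inverse `c`.
  have hcc : τ c = c := by
    calc τ c = τ c * (c * h x x) := by rw [hc, mul_one]
      _ = c * (τ c * h x x) := by ring
      _ = c := by rw [hcτ, mul_one]
  refine ⟨σ, ?_, ?_, hσ, ?_⟩
  · intro v w
    rw [hσ, hσ]
    simp only [map_add, LinearMap.add_apply, map_smul, LinearMap.smul_apply, map_smulₛₗ,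
      smul_eq_mul, map_mul, map_sub, map_one, hcc, hx w]
    linear_combination (h v x * τ (h w x) * c) * hu +
      ((u - 1 : R) * (τ u - 1) * c * h v x * τ (h w x)) * hc
  · ext
    rw [LinearEquiv.coe_det]
    change LinearMap.det (LinearMap.transvection f x) = _
    rw [LinearMap.transvection.det, hfx]
  · intro v
    rw [LinearEquiv.symm_apply_eq, hσ]
    simp only [map_add, LinearMap.add_apply, map_smul, LinearMap.smul_apply, smul_eq_mul]
    rw [add_assoc, ← add_smul, left_eq_add]
    convert zero_smul R x using 2
    have huu : (u : R) * (u⁻¹ : Rˣ) = 1 := u.mul_inv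
    linear_combination (c * h v x) * huu +
      ((u - 1 : R) * ((u⁻¹ : Rˣ) - 1 : R) * c * h v x) * hc

end QuasiReflection

/-! ### Pseudo-bases, determinant modules and Steinitz classes. -/

section Steinitz

universe u

variable {K : Type*} [Field K] [NumberField K]

section

variable {V : Type*} [AddCommGroup V] [Module K V] [Module (𝓞 K) V] [IsScalarTower (𝓞 K) K V]

theorem exists_smul_mem_of_isLattice {L : Submodule (𝓞 K) V} (hL : L.IsLattice K) (v : V) :
    ∃ s : 𝓞 K, s ≠ 0 ∧ s • v ∈ L := by
  have hv : v ∈ Submodule.span K (L : Set V) := hL.span_eq_top ▸ Submodule.mem_top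
  induction hv using Submodule.span_induction with
  | mem x hx => exact ⟨1, one_ne_zero, by rwa [one_smul]⟩
  | zero => exact ⟨1, one_ne_zero, by simp⟩
  | add x y _ _ hx hy =>
    obtain ⟨s, hs, hsx⟩ := hx
    obtain ⟨t, ht, hty⟩ := hy
    refine ⟨s * t, mul_ne_zero hs ht, ?_⟩
    rw [smul_add]
    refine L.add_mem ?_ ?_
    · rw [mul_comm, mul_smul]
      exact L.smul_mem t hsx
    · rw [mul_smul]
      exact L.smul_mem s hty
  | smul c x _ hx =>
    obtain ⟨s, hs, hsx⟩ := hx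
    obtain ⟨a, t, ht, rfl⟩ := IsFractionRing.div_surjective (A := 𝓞 K) c
    have ht0 : t ≠ 0 := nonZeroDivisors.ne_zero ht
    refine ⟨t * s, mul_ne_zero ht0 hs, ?_⟩
    have ht' : algebraMap (𝓞 K) K t ≠ 0 := by
      simpa using ht0
    have : (t * s) • (algebraMap (𝓞 K) K a / algebraMap (𝓞 K) K t) • x = a • s • x := by
      rw [← algebraMap_smul K (t * s), ← algebraMap_smul K a, ← algebraMap_smul K s,
        smul_smul, smul_smul, map_mul]
      congr 1
      field_simp
    rw [this]
    exact L.smul_mem a hsx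

theorem exists_image_eq_fractionalIdeal {L : Submodule (𝓞 K) V} (hL : L.IsLattice K)
    {f : V →ₗ[K] K} (hf : f ≠ 0) :
    ∃ a : (FractionalIdeal (𝓞 K)⁰ K)ˣ,
      ∀ y, y ∈ (a : FractionalIdeal (𝓞 K)⁰ K) ↔ ∃ v ∈ L, f v = y := by
  let I : FractionalIdeal (𝓞 K)⁰ K := ⟨L.map (f.restrictScalars (𝓞 K)),
    FractionalIdeal.isFractional_of_fg (hL.fg.map _)⟩
  have hmem : ∀ y, y ∈ I ↔ ∃ v ∈ L, f v = y := fun y => Iff.rfl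
  have hI : I ≠ 0 := by
    obtain ⟨v, hv⟩ : ∃ v, f v ≠ 0 := by
      by_contra! h
      exact hf (LinearMap.ext h)
    obtain ⟨s, hs, hsv⟩ := exists_smul_mem_of_isLattice hL v
    intro h0
    have : f (s • v) ∈ I := (hmem _).mpr ⟨_, hsv, rfl⟩
    rw [h0, FractionalIdeal.mem_zero_iff, ← algebraMap_smul K s, map_smul, smul_eq_mul] at this
    refine mul_ne_zero ?_ hv this
    simpa using hs
  exact ⟨Units.mk0 I hI, hmem⟩

/-- A functional `f` on a lattice splits over its image. -/
theorem exists_section_of_image_eq {L : Submodule (𝓞 K) V} {f : V →ₗ[K] K}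
    {a : (FractionalIdeal (𝓞 K)⁰ K)ˣ}
    (ha : ∀ y, y ∈ (a : FractionalIdeal (𝓞 K)⁰ K) ↔ ∃ v ∈ L, f v = y) :
    ∃ e : V, f e = 1 ∧ ∀ y ∈ (a : FractionalIdeal (𝓞 K)⁰ K), y • e ∈ L := by
  -- For `t = f v * b` take `e = b • v`; sums are harmless, and `t = 1` is reached because `a * a⁻¹
  -- = 1`.
  have key : ∀ t ∈ (a : FractionalIdeal (𝓞 K)⁰ K) * (a : FractionalIdeal (𝓞 K)⁰ K)⁻¹,
      ∃ e : V, f e = t ∧ ∀ y ∈ (a : FractionalIdeal (𝓞 K)⁰ K), y • e ∈ L := by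
    intro t ht
    rw [← FractionalIdeal.mem_coe, FractionalIdeal.coe_mul] at ht
    induction ht using Submodule.mul_induction_on' with
    | mem_mul_mem r hr b hb =>
      obtain ⟨v, hv, rfl⟩ := (ha r).mp hr
      refine ⟨b • v, by rw [map_smul, smul_eq_mul, mul_comm], fun y hy => ?_⟩
      have hby := (FractionalIdeal.mem_inv_iff a.ne_zero).mp hb y hy
      obtain ⟨z, hz⟩ := (FractionalIdeal.mem_one_iff _).mp hby
      rw [smul_smul, mul_comm, ← hz, algebraMap_smul]
      exact L.smul_mem z hv
    | add x _ y _ hx hy =>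
      obtain ⟨e, rfl, he'⟩ := hx
      obtain ⟨g, rfl, hg'⟩ := hy
      refine ⟨e + g, map_add f e g, fun y hy => ?_⟩
      rw [smul_add]
      exact L.add_mem (he' y hy) (hg' y hy)
  refine key 1 ?_
  rw [mul_inv_cancel₀ a.ne_zero]
  exact FractionalIdeal.one_mem_one _

theorem isLattice_comap_subtype {L : Submodule (𝓞 K) V} (hL : L.IsLattice K)
    (W : Submodule K V) :
    (L.comap (W.subtype.restrictScalars (𝓞 K))).IsLattice K := by
  refine ⟨?_, ?_⟩
  · refine Submodule.fg_of_fg_map_injective (W.subtype.restrictScalars (𝓞 K))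
      Subtype.val_injective ?_
    exact hL.fg.of_le (Submodule.map_comap_le _ _)
  · rw [eq_top_iff]
    intro w _
    obtain ⟨s, hs, hsw⟩ := exists_smul_mem_of_isLattice hL (w : V)
    have hs' : algebraMap (𝓞 K) K s ≠ 0 := by simpa using hs
    have : w = (algebraMap (𝓞 K) K s)⁻¹ • (s • w) := by
      rw [← algebraMap_smul K s w, inv_smul_smul₀ hs']
    rw [this]
    refine Submodule.smul_mem _ _ (Submodule.subset_span ?_)
    exact hsw

/-- The projection along `e` to the kernel of a functional `f` with `f e = 1`. -/
def projKer (f : V →ₗ[K] K) (e : V) (he : f e = 1) : V →ₗ[K] LinearMap.ker f :=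
  (LinearMap.id - f.smulRight e).codRestrict (LinearMap.ker f) fun v => by simp [he]

theorem coe_projKer (f : V →ₗ[K] K) (e : V) (he : f e = 1) (v : V) :
    (projKer f e he v : V) = v - f v • e := rfl

/-- The coordinates of `V` given by coordinates on the kernel of a functional `f` and a vector `e`
with `f e = 1`. -/
def consEquivFun {n : ℕ} (f : V →ₗ[K] K) (e : V) (he : f e = 1)
    (y : Basis (Fin n) K (LinearMap.ker f)) : V ≃ₗ[K] (Fin (n + 1) → K) where
  toFun v := Fin.cons (f v) (y.equivFun (projKer f e he v))
  invFun g := g 0 • e + (y.equivFun.symm (Fin.tail g) : V)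
  map_add' v w := by
    ext i
    refine Fin.cases ?_ (fun i => ?_) i <;> simp
  map_smul' c v := by
    ext i
    refine Fin.cases ?_ (fun i => ?_) i <;> simp
  left_inv v := by
    simp only [Fin.cons_zero, Fin.tail_cons, LinearEquiv.symm_apply_apply]
    rw [coe_projKer, add_sub_cancel]
  right_inv g := by
    obtain ⟨w, hw⟩ : ∃ w, w = y.equivFun.symm (Fin.tail g) := ⟨_, rfl⟩
    have hfw : f w = 0 := LinearMap.mem_ker.mp w.2
    have h0 : f (g 0 • e + (w : V)) = g 0 := by
      rw [map_add, map_smul, he, hfw]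
      simp
    have h1 : projKer f e he (g 0 • e + (w : V)) = w := by
      ext
      rw [coe_projKer, h0, add_sub_cancel_left]
    beta_reduce
    rw [← hw, h1, h0, hw, LinearEquiv.apply_symm_apply, Fin.cons_self_tail]

end

/-- A lattice over the integers of a number field is a direct sum of multiples of vectors by
fractional ideals. -/
theorem exists_pseudoBasis (n : ℕ) {V : Type u} [AddCommGroup V] [Module K V]
    [FiniteDimensional K V] [Module (𝓞 K) V] [IsScalarTower (𝓞 K) K V] (hn : finrank K V = n)
    {L : Submodule (𝓞 K) V} (hL : L.IsLattice K) :
    ∃ (x : Basis (Fin n) K V) (a : Fin n → (FractionalIdeal (𝓞 K)⁰ K)ˣ),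
      ∀ v, v ∈ L ↔ ∀ i, x.repr v i ∈ (a i : FractionalIdeal (𝓞 K)⁰ K) := by
  induction n generalizing V with
  | zero =>
    have : Subsingleton V := finrank_zero_iff.mp hn
    refine ⟨finBasisOfFinrankEq K V hn, fun i => i.elim0, fun v => ?_⟩
    rw [Subsingleton.elim v 0]
    simp
  | succ n ih =>
    let f : V →ₗ[K] K := (finBasisOfFinrankEq K V hn).coord 0
    have hf : f ≠ 0 := fun h => by
      have := DFunLike.congr_fun h (finBasisOfFinrankEq K V hn 0)
      simp [f] at this
    obtain ⟨a, ha⟩ := exists_image_eq_fractionalIdeal hL hf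
    -- This splits `L` as `a • e ⊕ (L ∩ ker f)`, and the induction applies to the kernel.
    obtain ⟨e, he, hae⟩ := exists_section_of_image_eq ha
    have hker : finrank K (LinearMap.ker f) = n := by
      have h1 := LinearMap.finrank_range_add_finrank_ker f
      rw [LinearMap.range_eq_top.mpr (LinearMap.surjective_of_ne_zero hf), finrank_top,
        finrank_self, hn] at h1
      omega
    obtain ⟨y, b, hb⟩ := ih hker (isLattice_comap_subtype hL (LinearMap.ker f))
    refine ⟨Basis.ofEquivFun (consEquivFun f e he y), Fin.cons a b, fun v => ?_⟩
    rw [Fin.forall_fin_succ]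
    have h0 : (Basis.ofEquivFun (consEquivFun f e he y)).repr v 0 = f v := by
      simp [Basis.ofEquivFun, consEquivFun]
    have hs : ∀ i : Fin n, (Basis.ofEquivFun (consEquivFun f e he y)).repr v i.succ =
        y.repr (projKer f e he v) i := by
      intro i
      simp [Basis.ofEquivFun, consEquivFun]
    simp only [h0, hs, Fin.cons_zero, Fin.cons_succ]
    rw [← hb]
    change v ∈ L ↔ f v ∈ (a : FractionalIdeal (𝓞 K)⁰ K) ∧ v - f v • e ∈ L
    constructor
    · intro hv
      have h1 := (ha _).mpr ⟨v, hv, rfl⟩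
      exact ⟨h1, L.sub_mem hv (hae _ h1)⟩
    · rintro ⟨h1, h2⟩
      rw [← sub_add_cancel v (f v • e)]
      exact L.add_mem h2 (hae _ h1)

variable {V : Type*} [AddCommGroup V] [Module K V] [Module (𝓞 K) V] [IsScalarTower (𝓞 K) K V]
  {ι : Type*} [Fintype ι] [DecidableEq ι]

/-- The module spanned by the determinants of the families of vectors of `L`: the top exterior
power of `L`, in terms of a basis of `V`. -/
def detIdeal (b : Basis ι K V) (L : Submodule (𝓞 K) V) : Submodule (𝓞 K) K :=
  Submodule.span (𝓞 K) {y | ∃ v : ι → V, (∀ i, v i ∈ L) ∧ b.det v = y}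

theorem smul_mem_of_mem {x : Basis ι K V} {a : ι → (FractionalIdeal (𝓞 K)⁰ K)ˣ}
    {L : Submodule (𝓞 K) V}
    (hx : ∀ v, v ∈ L ↔ ∀ i, x.repr v i ∈ (a i : FractionalIdeal (𝓞 K)⁰ K)) {i : ι} {z : K}
    (hz : z ∈ (a i : FractionalIdeal (𝓞 K)⁰ K)) : z • x i ∈ L := by
  refine (hx _).mpr fun j => ?_
  rw [map_smul, x.repr_self, Finsupp.smul_apply, Finsupp.single_apply]
  split_ifs with hij
  · subst hij
    simpa using hz
  · rw [smul_zero]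
    exact Submodule.zero_mem ((a j : FractionalIdeal (𝓞 K)⁰ K) : Submodule (𝓞 K) K)

/-- Each term of the Leibniz formula takes one coordinate from each `a i`; conversely the families
`g i • x i` realize all products. -/
theorem detIdeal_eq_prod {x : Basis ι K V} {a : ι → (FractionalIdeal (𝓞 K)⁰ K)ˣ}
    {L : Submodule (𝓞 K) V}
    (hx : ∀ v, v ∈ L ↔ ∀ i, x.repr v i ∈ (a i : FractionalIdeal (𝓞 K)⁰ K)) :
    detIdeal x L = ((∏ i, a i : (FractionalIdeal (𝓞 K)⁰ K)ˣ) : FractionalIdeal (𝓞 K)⁰ K) := by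
  have hprod : (((∏ i, a i : (FractionalIdeal (𝓞 K)⁰ K)ˣ) : FractionalIdeal (𝓞 K)⁰ K) :
      Submodule (𝓞 K) K) = Submodule.span (𝓞 K)
        (∏ i, ((a i : FractionalIdeal (𝓞 K)⁰ K) : Set K)) := by
    rw [← Submodule.prod_span, Units.coe_prod]
    have := map_prod (FractionalIdeal.coeSubmoduleHom (𝓞 K)⁰ K)
      (fun i => (a i : FractionalIdeal (𝓞 K)⁰ K)) Finset.univ
    refine this.trans (Finset.prod_congr rfl fun i _ => ?_)
    exact (Submodule.span_eq _).symm
  rw [hprod]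
  apply le_antisymm
  · refine Submodule.span_le.mpr ?_
    rintro _ ⟨v, hv, rfl⟩
    rw [Basis.det_apply, Matrix.det_apply]
    refine Submodule.sum_mem _ fun σ _ => ?_
    have hmem : ∏ i, x.toMatrix v (σ i) i ∈ Submodule.span (𝓞 K)
        (∏ i, ((a i : FractionalIdeal (𝓞 K)⁰ K) : Set K)) := by
      have hσ : ∏ i, x.toMatrix v (σ i) i = ∏ i, x.toMatrix v i (σ.symm i) := by
        rw [← Equiv.prod_comp σ (fun i => x.toMatrix v i (σ.symm i))]
        simp
      rw [hσ]
      refine Submodule.subset_span ((Set.mem_fintype_prod _ _).mpr ⟨_, fun i => ?_, rfl⟩)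
      exact (hx _).mp (hv _) i
    rcases Int.units_eq_one_or (Equiv.Perm.sign σ) with h | h <;> rw [h]
    · rwa [one_smul]
    · rw [Units.neg_smul, one_smul]
      exact Submodule.neg_mem _ hmem
  · refine Submodule.span_mono ?_
    intro y hy
    obtain ⟨g, hg, rfl⟩ := (Set.mem_fintype_prod _ _).mp hy
    refine ⟨fun i => g i • x i, fun i => smul_mem_of_mem hx (hg i), ?_⟩
    · change x.det.toMultilinearMap (fun i => g i • x i) = _
      rw [MultilinearMap.map_smul_univ]
      simp [Basis.det_self]

theorem detIdeal_eq_map (b x : Basis ι K V) (L : Submodule (𝓞 K) V) :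
    detIdeal b L = (detIdeal x L).map (LinearMap.mulLeft (𝓞 K) (b.det x)) := by
  rw [detIdeal, detIdeal, Submodule.map_span]
  congr 1
  have hb : ∀ v, b.det v = b.det x * x.det v := fun v =>
    DFunLike.congr_fun (AlternatingMap.eq_smul_basis_det x b.det) v
  ext y
  constructor
  · rintro ⟨v, hv, rfl⟩
    exact ⟨_, ⟨v, hv, rfl⟩, (hb v).symm⟩
  · rintro ⟨_, ⟨v, hv, rfl⟩, rfl⟩
    exact ⟨v, hv, hb v⟩

/-- A change of basis only rescales the determinant module, so its class is the one read off from
any pseudo-basis. Hence the Steinitz class is unique. -/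
theorem HasSteinitzClass.exists_eq_detIdeal {L : Submodule (𝓞 K) V} {c : ClassGroup (𝓞 K)}
    (hc : HasSteinitzClass L c) (b : Basis (Fin (finrank K V)) K V) :
    ∃ I : (FractionalIdeal (𝓞 K)⁰ K)ˣ,
      detIdeal b L = (I : FractionalIdeal (𝓞 K)⁰ K) ∧ ClassGroup.mk K I = c := by
  obtain ⟨x, a, hx, rfl⟩ := hc
  refine ⟨toPrincipalIdeal (𝓞 K) K (b.isUnit_det x).unit * ∏ i, a i, ?_, ?_⟩
  · rw [detIdeal_eq_map b x, detIdeal_eq_prod hx]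
    ext y
    rw [Units.val_mul, coe_toPrincipalIdeal, FractionalIdeal.mem_coe,
      FractionalIdeal.mem_singleton_mul, Submodule.mem_map]
    simp only [FractionalIdeal.mem_coe, LinearMap.mulLeft_apply, IsUnit.unit_spec]
    exact exists_congr fun z => and_congr_right fun _ => eq_comm
  · rw [map_mul]
    convert one_mul _
    rw [ClassGroup.mk_eq_one_iff]
    simp only [coe_toPrincipalIdeal, FractionalIdeal.coe_spanSingleton]
    exact ⟨_, rfl⟩

theorem exists_hasSteinitzClass [FiniteDimensional K V] {L : Submodule (𝓞 K) V}
    (hL : L.IsLattice K) : ∃ c, HasSteinitzClass L c := by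
  obtain ⟨x, a, hx⟩ := exists_pseudoBasis _ rfl hL
  exact ⟨_, x, a, hx, rfl⟩

theorem exists_eq_detIdeal [FiniteDimensional K V] {L : Submodule (𝓞 K) V} (hL : L.IsLattice K)
    (b : Basis (Fin (finrank K V)) K V) :
    ∃ I : (FractionalIdeal (𝓞 K)⁰ K)ˣ,
      detIdeal b L = (I : FractionalIdeal (𝓞 K)⁰ K) ∧ ClassGroup.mk K I = steinitzClass L :=
  (Classical.epsilon_spec (exists_hasSteinitzClass hL)).exists_eq_detIdeal b

theorem steinitzClass_eq_of_detIdeal_eq [FiniteDimensional K V] {L N : Submodule (𝓞 K) V}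
    (hL : L.IsLattice K) (hN : N.IsLattice K) {b : Basis (Fin (finrank K V)) K V}
    (h : detIdeal b N = detIdeal b L) : steinitzClass N = steinitzClass L := by
  obtain ⟨I, hI, hIc⟩ := exists_eq_detIdeal hL b
  obtain ⟨J, hJ, hJc⟩ := exists_eq_detIdeal hN b
  have : J = I := by
    ext1
    apply FractionalIdeal.coeToSubmodule_injective
    exact hJ.symm.trans (h.trans hI)
  rw [← hIc, ← hJc, this]

theorem exists_detIdeal_eq_map_of_steinitzClass_eq [FiniteDimensional K V]
    {L N : Submodule (𝓞 K) V} (hL : L.IsLattice K) (hN : N.IsLattice K)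
    (b : Basis (Fin (finrank K V)) K V) (h : steinitzClass N = steinitzClass L) :
    ∃ d : Kˣ, detIdeal b N = (detIdeal b L).map (LinearMap.mulLeft (𝓞 K) (d : K)) := by
  obtain ⟨I, hI, hIc⟩ := exists_eq_detIdeal hL b
  obtain ⟨J, hJ, hJc⟩ := exists_eq_detIdeal hN b
  have h1 : ClassGroup.mk K (J * I⁻¹) = 1 := by
    rw [map_mul, map_inv, hIc, hJc, h, mul_inv_cancel]
  rw [ClassGroup.mk_eq_one_iff, FractionalIdeal.isPrincipal_iff] at h1
  obtain ⟨d, hd⟩ := h1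
  have hd0 : d ≠ 0 := by
    rintro rfl
    rw [FractionalIdeal.spanSingleton_zero] at hd
    exact (J * I⁻¹).ne_zero hd
  refine ⟨Units.mk0 d hd0, ?_⟩
  have hJI : (J : FractionalIdeal (𝓞 K)⁰ K) =
      FractionalIdeal.spanSingleton (𝓞 K)⁰ d * (I : FractionalIdeal (𝓞 K)⁰ K) := by
    rw [← hd, Units.val_mul, mul_assoc, Units.inv_mul, mul_one]
  rw [hI, hJ, hJI]
  ext y
  rw [FractionalIdeal.mem_coe, FractionalIdeal.mem_singleton_mul, Submodule.mem_map]
  simp only [FractionalIdeal.mem_coe, LinearMap.mulLeft_apply, Units.val_mk0]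
  exact exists_congr fun z => and_congr_right fun _ => eq_comm

end Steinitz

/-! ### Vectors of norm prime to `p` in a unimodular lattice of odd rank. -/

section Unimodular

variable {K : Type*} [Field K] [NumberField K] {conj : K ≃ₐ[ℚ] K}
  {V : Type*} [AddCommGroup V] [Module K V] [Module (𝓞 K) V] [IsScalarTower (𝓞 K) K V]

/-- As `a * a⁻¹ = 1` is not contained in `P`, some product avoids `P`. For prime `P`, `α` then
generates `a` locally at `P`, which replaces localization in what follows. -/
theorem exists_mem_mul_mem_inv_notMem (a : (FractionalIdeal (𝓞 K)⁰ K)ˣ) {P : Ideal (𝓞 K)}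
    (hP : P ≠ ⊤) :
    ∃ α ∈ (a : FractionalIdeal (𝓞 K)⁰ K), ∃ β ∈ (a : FractionalIdeal (𝓞 K)⁰ K)⁻¹,
      ∃ s : 𝓞 K, s ∉ P ∧ (s : K) = α * β := by
  by_contra! H
  apply hP
  have hle : (a : FractionalIdeal (𝓞 K)⁰ K) * (a : FractionalIdeal (𝓞 K)⁰ K)⁻¹ ≤
      (P : FractionalIdeal (𝓞 K)⁰ K) := by
    rw [FractionalIdeal.mul_le]
    intro α hα β hβ
    obtain ⟨s, hs⟩ := (FractionalIdeal.mem_one_iff _).mp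
      ((FractionalIdeal.mem_inv_iff a.ne_zero).mp hβ α hα)
    rw [mul_comm, ← hs]
    by_contra hsP
    refine H α hα β hβ s (fun h => hsP ?_) (hs.trans (mul_comm _ _))
    exact FractionalIdeal.mem_coeIdeal_of_mem _ h
  rw [mul_inv_cancel₀ a.ne_zero] at hle
  have h1 := hle (FractionalIdeal.one_mem_one _)
  obtain ⟨t, ht, ht1⟩ := (FractionalIdeal.mem_coeIdeal _).mp h1
  rw [Ideal.eq_top_iff_one]
  have : t = 1 := by
    apply FaithfulSMul.algebraMap_injective (𝓞 K) K
    rw [ht1, map_one]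
  exact this ▸ ht

variable {h : V →ₗ[K] V →ₛₗ[(conj : K →+* K)] K} {L : Submodule (𝓞 K) V}
  {ι : Type*} [Fintype ι] [DecidableEq ι] {x : Basis ι K V}
  {a : ι → (FractionalIdeal (𝓞 K)⁰ K)ˣ}

theorem exists_eq_form_of_dual_eq (hd : dual h L = L) {v w : V} (hv : v ∈ L) (hw : w ∈ L) :
    ∃ r : 𝓞 K, (r : K) = h v w := by
  rw [← hd] at hv
  exact hv w hw

/-- The reduction modulo a prime ideal of the form on a unimodular lattice is nondegenerate. -/
theorem coeff_mem_of_form_mem (hd : dual h L = L)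
    (hx : ∀ v, v ∈ L ↔ ∀ i, x.repr v i ∈ (a i : FractionalIdeal (𝓞 K)⁰ K))
    {P : Ideal (𝓞 K)} [P.IsPrime] (hP0 : P ≠ ⊥) {α β : ι → K} {s : ι → 𝓞 K}
    (hβ : ∀ i, β i ∈ (a i : FractionalIdeal (𝓞 K)⁰ K)⁻¹)
    (hs : ∀ i, s i ∉ P) (hαβ : ∀ i, (s i : K) = α i * β i) {c : ι → 𝓞 K}
    (hc : ∀ l ∈ L, h (∑ i, (c i * α i : K) • x i) l ∈ (P : FractionalIdeal (𝓞 K)⁰ K)) (i : ι) :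
    c i ∈ P := by
  have hP' : (P : FractionalIdeal (𝓞 K)⁰ K) ≠ 0 := FractionalIdeal.coeIdeal_ne_zero.mpr hP0
  have hmem : ((c i * s i : 𝓞 K) : K) ∈ ((P : FractionalIdeal (𝓞 K)⁰ K)⁻¹)⁻¹ := by
    rw [FractionalIdeal.mem_inv_iff (inv_ne_zero hP')]
    intro q hq
    -- Multiplying by `P⁻¹` keeps the vector in the dual, which is `L`.
    have hqw : q • (∑ i, (c i * α i : K) • x i) ∈ L := by
      rw [← hd]
      intro l hl
      rw [map_smul, LinearMap.smul_apply, smul_eq_mul]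
      exact (FractionalIdeal.mem_one_iff _).mp
        ((FractionalIdeal.mem_inv_iff hP').mp hq _ (hc l hl))
    have hi := (hx _).mp hqw i
    rw [map_smul, Finsupp.smul_apply, x.repr_sum_self, smul_eq_mul] at hi
    have := (FractionalIdeal.mem_inv_iff (a i).ne_zero).mp (hβ i) _ hi
    convert this using 1
    change (c i : K) * (s i : K) * q = _
    rw [hαβ]
    ring
  rw [inv_inv] at hmem
  obtain ⟨t, ht, hts⟩ := (FractionalIdeal.mem_coeIdeal _).mp hmem
  have hts' : t = c i * s i := FaithfulSMul.algebraMap_injective (𝓞 K) K hts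
  rw [hts'] at ht
  exact (Ideal.IsPrime.mem_or_mem ‹_› ht).resolve_right (hs i)

/-- The values of the form on a nonzero unimodular lattice generate the unit ideal. -/
theorem span_form_eq_top [Nonempty ι] (hd : dual h L = L)
    (hx : ∀ v, v ∈ L ↔ ∀ i, x.repr v i ∈ (a i : FractionalIdeal (𝓞 K)⁰ K)) :
    Ideal.span {r : 𝓞 K | ∃ v ∈ L, ∃ w ∈ L, (r : K) = h v w} = ⊤ := by
  by_contra hJ
  obtain ⟨P, hPmax, hJP⟩ := Ideal.exists_le_maximal _ hJ
  have hP0 : P ≠ ⊥ := Ring.ne_bot_of_isMaximal_of_not_isField hPmax (RingOfIntegers.not_isField K)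
  choose α hα β hβ s hs hαβ using fun i => exists_mem_mul_mem_inv_notMem (a i) hPmax.ne_top
  obtain ⟨i₀⟩ := ‹Nonempty ι›
  have h1 := coeff_mem_of_form_mem hd hx hP0 hβ hs hαβ (c := Pi.single i₀ 1) (i := i₀) (by
    intro l hl
    have hw : ∑ i, (((Pi.single i₀ 1 : ι → 𝓞 K) i : 𝓞 K) * α i : K) • x i = α i₀ • x i₀ := by
      rw [Finset.sum_eq_single i₀]
      · simp
      · intro j _ hj
        simp [Pi.single_eq_of_ne hj]
      · simp
    rw [hw]
    have hwL := smul_mem_of_mem hx (hα i₀)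
    obtain ⟨r, hr⟩ := exists_eq_form_of_dual_eq hd hwL hl
    rw [← hr]
    exact FractionalIdeal.mem_coeIdeal_of_mem _
      (hJP (Ideal.subset_span ⟨_, hwL, _, hl, hr⟩)))
  rw [Pi.single_eq_same] at h1
  exact hPmax.ne_top ((Ideal.eq_top_iff_one _).mpr h1)

/-- A unimodular lattice of odd rank contains, for every prime `p`, a vector whose norm is prime
to `p`. -/
theorem exists_norm_not_dvd (hK : finrank ℚ K = 2) (hconj : conj ≠ 1) (hh : IsHermitian h)
    (hι : Odd (Fintype.card ι)) (hd : dual h L = L)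
    (hx : ∀ v, v ∈ L ↔ ∀ i, x.repr v i ∈ (a i : FractionalIdeal (𝓞 K)⁰ K))
    {p : ℕ} (hp : p.Prime) : ∃ v ∈ L, ∃ m : ℤ, (m : K) = h v v ∧ ¬ (p : ℤ) ∣ m := by
  by_contra! H
  have hnorm : ∀ v ∈ L, ∃ m : ℤ, h v v = p * m := by
    intro v hv
    obtain ⟨r, hr⟩ := exists_eq_form_of_dual_eq hd hv hv
    obtain ⟨m, hm⟩ := exists_int_eq_of_conj_eq hK hconj (a := r) (by
      rw [hr]; exact (hh v v).symm)
    obtain ⟨k, rfl⟩ := H v hv m (hm.trans hr)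
    exact ⟨k, by rw [← hr, ← hm]; push_cast; rfl⟩
  have htrace : ∀ v ∈ L, ∀ w ∈ L, ∃ m : ℤ, h v w + conj (h v w) = p * m := by
    intro v hv w hw
    obtain ⟨m₁, h₁⟩ := hnorm v hv
    obtain ⟨m₂, h₂⟩ := hnorm w hw
    obtain ⟨m₃, h₃⟩ := hnorm (v + w) (L.add_mem hv hw)
    refine ⟨m₃ - m₁ - m₂, ?_⟩
    have h4 : conj (h v w) = h w v := (hh w v).symm
    simp only [map_add, LinearMap.add_apply] at h₃
    rw [h4]
    push_cast
    linear_combination h₃ - h₁ - h₂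
  have : Nonempty ι := Fintype.card_pos_iff.mp hι.pos
  -- The traces of the values of `h` are divisible by `p`, and these values generate the unit ideal.
  have htr : ∀ r : 𝓞 K, ∃ m : ℤ, (r : K) + conj r = p * m := by
    intro r
    suffices hspan : ∀ y ∈ Ideal.span {r : 𝓞 K | ∃ v ∈ L, ∃ w ∈ L, (r : K) = h v w},
        ∀ c : 𝓞 K, ∃ m : ℤ, ((c * y : 𝓞 K) : K) + conj ((c * y : 𝓞 K) : K) = p * m by
      have := hspan 1 (by rw [span_form_eq_top hd hx]; exact Submodule.mem_top) r
      rwa [mul_one] at this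
    intro y hy
    induction hy using Submodule.span_induction with
    | mem y hy =>
      intro c
      obtain ⟨v, hv, w, hw, hvw⟩ := hy
      have : ((c * y : 𝓞 K) : K) = h (c • v) w := by
        rw [← algebraMap_smul K c v, map_smul, LinearMap.smul_apply, ← hvw]
        simp
      rw [this]
      exact htrace _ (L.smul_mem c hv) _ hw
    | zero => exact fun c => ⟨0, by simp⟩
    | add y z _ _ hy hz =>
      intro c
      obtain ⟨m, hm⟩ := hy c
      obtain ⟨k, hk⟩ := hz c
      refine ⟨m + k, ?_⟩
      simp only [mul_add, map_add, Int.cast_add]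
      linear_combination hm + hk
    | smul b y _ hy =>
      intro c
      rw [smul_eq_mul, ← mul_assoc]
      exact hy (c * b)
  -- The trace of `1` is `2`.
  have hp2 : p = 2 := by
    obtain ⟨m, hm⟩ := htr 1
    have : (2 : ℤ) = p * m := by
      have : ((2 : ℤ) : K) = ((p * m : ℤ) : K) := by
        push_cast
        rw [← hm]
        simp
        norm_num
      exact_mod_cast this
    have hdvd : p ∣ 2 := Int.natCast_dvd_natCast.mp ⟨m, this⟩
    exact (Nat.prime_dvd_prime_iff_eq hp Nat.prime_two).mp hdvd
  subst hp2
  have h2 : Ideal.span {(2 : 𝓞 K)} ≠ ⊤ := by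
    rw [Ne, Ideal.span_singleton_eq_top]
    intro hu
    obtain ⟨r, hr⟩ := hu.exists_left_inv
    have hr' : (r : K) * 2 = 1 := by
      have := congrArg (algebraMap (𝓞 K) K) hr
      rwa [map_mul, map_ofNat, map_one] at this
    have hr2 : conj (r : K) * 2 = 1 := by
      have := congrArg conj hr'
      rwa [map_mul, map_ofNat, map_one] at this
    obtain ⟨m, hm⟩ := htr r
    have h1 : ((1 : ℤ) : K) = ((2 * m : ℤ) : K) := by
      push_cast at hm ⊢
      rw [← hm]
      have h20 : (2 : K) ≠ 0 := two_ne_zero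
      apply mul_right_cancel₀ h20
      linear_combination -hr' - hr2
    have h1' : (1 : ℤ) = 2 * m := by exact_mod_cast h1
    omega
  obtain ⟨P, hPmax, h2P⟩ := Ideal.exists_le_maximal _ h2
  have h2P : (2 : 𝓞 K) ∈ P := h2P (Ideal.mem_span_singleton_self _)
  have hP0 : P ≠ ⊥ := Ring.ne_bot_of_isMaximal_of_not_isField hPmax (RingOfIntegers.not_isField K)
  -- As all traces are even, conjugation is trivial modulo `P`; so the form reduces to a symmetric
  -- one with zero diagonal.
  have hconjP : ∀ r : 𝓞 K, ∃ t : 𝓞 K, (t : K) = conj r ∧ t - r ∈ P := by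
    intro r
    obtain ⟨m, hm⟩ := htr r
    refine ⟨2 * m - r, ?_, ?_⟩
    · push_cast at hm
      simp only [map_sub, map_mul, map_ofNat, map_intCast]
      linear_combination -hm
    · have : 2 * (m : 𝓞 K) - r - r = 2 * (m - r) := by ring
      rw [this]
      exact P.mul_mem_right _ h2P
  choose α hα β hβ s hs hαβ using fun i => exists_mem_mul_mem_inv_notMem (a i) hPmax.ne_top
  have hαL : ∀ i, α i • x i ∈ L := fun i => smul_mem_of_mem hx (hα i)
  choose A hA using fun i j => exists_eq_form_of_dual_eq hd (hαL i) (hαL j)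
  let _ := Ideal.Quotient.field P
  have : CharP (𝓞 K ⧸ P) 2 := by
    refine CharTwo.of_one_ne_zero_of_two_eq_zero one_ne_zero ?_
    have := Ideal.Quotient.eq_zero_iff_mem.mpr h2P
    rwa [map_ofNat] at this
  let B : Matrix ι ι (𝓞 K ⧸ P) := Matrix.of fun i j => Ideal.Quotient.mk P (A i j)
  have hB : B.det = 0 := by
    refine det_eq_zero_of_isSymm_of_diag_eq_zero hι ?_ ?_
    · refine Matrix.IsSymm.ext fun i j => ?_
      change Ideal.Quotient.mk P (A j i) = Ideal.Quotient.mk P (A i j)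
      rw [Ideal.Quotient.eq]
      obtain ⟨t, ht, htP⟩ := hconjP (A i j)
      have : A j i = t := by
        apply FaithfulSMul.algebraMap_injective (𝓞 K) K
        change (A j i : K) = (t : K)
        rw [ht, hA, hA]
        exact hh _ _
      rwa [this]
    · intro i
      change Ideal.Quotient.mk P (A i i) = 0
      rw [Ideal.Quotient.eq_zero_iff_mem]
      obtain ⟨m, hm⟩ := hnorm _ (hαL i)
      have : A i i = 2 * m := by
        apply FaithfulSMul.algebraMap_injective (𝓞 K) K
        change (A i i : K) = _
        rw [hA, hm, map_mul, map_ofNat, map_intCast]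
        rfl
      rw [this]
      exact P.mul_mem_right _ h2P
  obtain ⟨c', hc'0, hc'⟩ := Matrix.exists_vecMul_eq_zero_iff.mpr hB
  choose c hc using fun i => Ideal.Quotient.mk_surjective (I := P) (c' i)
  apply hc'0
  ext i
  rw [← hc, Pi.zero_apply, Ideal.Quotient.eq_zero_iff_mem]
  refine coeff_mem_of_form_mem hd hx hP0 hβ hs hαβ (fun l hl => ?_) i
  have hw : ∑ i, (c i * α i : K) • x i ∈ L := by
    refine L.sum_mem fun i _ => ?_
    rw [mul_smul]
    change algebraMap (𝓞 K) K (c i) • α i • x i ∈ L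
    rw [algebraMap_smul]
    exact L.smul_mem _ (hαL i)
  have hgram : ∀ j, h (∑ i, (c i * α i : K) • x i) (α j • x j) =
      ((∑ i, c i * A i j : 𝓞 K) : K) := by
    intro j
    change _ = algebraMap (𝓞 K) K (∑ i, c i * A i j)
    rw [map_sum h, LinearMap.sum_apply, map_sum (algebraMap (𝓞 K) K)]
    refine Finset.sum_congr rfl fun i _ => ?_
    rw [mul_smul, LinearMap.map_smul, LinearMap.smul_apply, smul_eq_mul, ← hA, map_mul]
  generalize (∑ i, (c i * α i : K) • x i) = w at *
  have hgramP : ∀ j, ∑ i, c i * A i j ∈ P := by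
    intro j
    rw [← Ideal.Quotient.eq_zero_iff_mem, map_sum]
    have := congrFun hc' j
    simp only [Matrix.vecMul, dotProduct, ← hc] at this
    simpa [B] using this
  have hcoord : ∀ j, ∀ z ∈ (a j : FractionalIdeal (𝓞 K)⁰ K),
      h w (z • x j) ∈ (P : FractionalIdeal (𝓞 K)⁰ K) := by
    intro j z hz
    obtain ⟨r, hr⟩ := exists_eq_form_of_dual_eq hd hw (smul_mem_of_mem hx hz)
    obtain ⟨t, ht⟩ := (FractionalIdeal.mem_one_iff _).mp
      ((FractionalIdeal.mem_inv_iff (a j).ne_zero).mp (hβ j) z hz)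
    obtain ⟨t', ht', -⟩ := hconjP t
    obtain ⟨s', hs', hsP⟩ := hconjP (s j)
    have hs'P : s' ∉ P := fun h' => hs j (by simpa using P.sub_mem h' hsP)
    -- Since `s j * z = α j * t`, conjugating the scalars expresses `h w (z • x j)` by the Gram
    -- matrix up to a factor outside `P`.
    have heq : s' * r = t' * ∑ i, c i * A i j := by
      apply FaithfulSMul.algebraMap_injective (𝓞 K) K
      rw [map_mul, map_mul]
      change (s' : K) * (r : K) = (t' : K) * ((∑ i, c i * A i j : 𝓞 K) : K)
      rw [← hgram, hr, hs', ht', map_smulₛₗ, map_smulₛₗ, smul_eq_mul, smul_eq_mul,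
        ← mul_assoc, ← mul_assoc]
      congr 1
      change conj _ * conj _ = conj _ * conj _
      rw [← map_mul, ← map_mul]
      congr 1
      rw [hαβ]
      change _ = algebraMap (𝓞 K) K t * _
      rw [ht]
      ring
    have hrP : r ∈ P := by
      have : s' * r ∈ P := heq ▸ P.mul_mem_left _ (hgramP j)
      exact (Ideal.IsPrime.mem_or_mem hPmax.isPrime this).resolve_left hs'P
    rw [← hr]
    exact FractionalIdeal.mem_coeIdeal_of_mem _ hrP
  rw [← x.sum_repr l, map_sum]
  exact Submodule.sum_mem ((P : FractionalIdeal (𝓞 K)⁰ K) : Submodule (𝓞 K) K)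
    fun j _ => hcoord j _ ((hx l).mp hl j)

end Unimodular

/-! ### Integrality from local data, and determinants of isometries. -/

theorem _root_.Rat.exists_int_eq_of_norm_le_one {q : ℚ}
    (hq : ∀ (p : ℕ) [Fact p.Prime], ‖(q : ℚ_[p])‖ ≤ 1) : ∃ m : ℤ, (m : ℚ) = q := by
  refine ⟨q.num, ?_⟩
  rw [← Rat.den_eq_one_iff]
  by_contra hden
  obtain ⟨p, hp, hpd⟩ := Nat.exists_prime_and_dvd hden
  have : Fact p.Prime := ⟨hp⟩
  have h1 : ‖((q.den : ℤ) : ℚ_[p])‖ < 1 :=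
    Padic.norm_intCast_lt_one_iff.mpr (Int.natCast_dvd_natCast.mpr hpd)
  have h2 : ‖(q.num : ℚ_[p])‖ < 1 := by
    have h3 : (q.num : ℚ_[p]) = (q : ℚ_[p]) * ((q.den : ℤ) : ℚ_[p]) := by
      have := Rat.mul_den_eq_num q
      exact_mod_cast (congrArg (fun r : ℚ => (r : ℚ_[p])) this).symm
    rw [h3, norm_mul]
    exact lt_of_le_of_lt (mul_le_of_le_one_left (norm_nonneg _) (hq p)) h1
  have h4 := Padic.norm_intCast_lt_one_iff.mp h2
  have h5 : p ∣ q.num.natAbs := Int.natCast_dvd.mp h4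
  exact hp.one_lt.ne' (Nat.dvd_one.mp (q.reduced ▸ Nat.dvd_gcd h5 hpd))

section MultilinearSpan

variable {R A M ι : Type*} [CommRing A] [CommRing R] [Algebra R A] [AddCommGroup M] [Module A M]
  [Module R M] [IsScalarTower R A M] [Fintype ι] [DecidableEq ι]

/-- A multilinear map over a larger ring maps families in the span of `S` to the span of its values
on families in `S`. -/
theorem map_mem_of_forall_mem_span (f : MultilinearMap A (fun _ : ι => M) A) {S : Set M}
    {P : Submodule R A} (hS : ∀ v : ι → M, (∀ i, v i ∈ S) → f v ∈ P) {v : ι → M}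
    (hv : ∀ i, v i ∈ Submodule.span R S) : f v ∈ P := by
  -- The arguments are freed from `S` to its span one index at a time.
  suffices H : ∀ (s : Finset ι) (v : ι → M), (∀ i ∈ s, v i ∈ Submodule.span R S) →
      (∀ i ∉ s, v i ∈ S) → f v ∈ P from H Finset.univ v (fun i _ => hv i) (by simp)
  intro s
  induction s using Finset.induction_on with
  | empty => exact fun v _ h => hS v (by simpa using h)
  | insert i s his ih =>
    intro v h1 h2
    have key : ∀ y ∈ Submodule.span R S, f (Function.update v i y) ∈ P := by
      intro y hy
      induction hy using Submodule.span_induction with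
      | mem y hy =>
        refine ih _ (fun j hj => ?_) (fun j hj => ?_)
        · rw [Function.update_of_ne (by rintro rfl; exact his hj)]
          exact h1 j (Finset.mem_insert_of_mem hj)
        · by_cases hji : j = i
          · subst hji
            rwa [Function.update_self]
          · rw [Function.update_of_ne hji]
            exact h2 j (by simp [hji, hj])
      | zero => rw [MultilinearMap.map_update_zero]; exact P.zero_mem
      | add y z _ _ hy hz => rw [MultilinearMap.map_update_add]; exact P.add_mem hy hz
      | smul c y _ hy =>
        rw [← algebraMap_smul A c y, MultilinearMap.map_update_smul, algebraMap_smul]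
        exact P.smul_mem c hy
    have := key (v i) (h1 i (Finset.mem_insert_self i s))
    rwa [Function.update_eq_self] at this

end MultilinearSpan

section UnitaryDet

variable {R : Type*} [CommRing R] {τ : R →+* R} {M : Type*} [AddCommGroup M] [Module R M]
  {ι : Type*} [Fintype ι] [DecidableEq ι]

/-- The Gram matrix of a form in terms of a basis. -/
def gram (h : M →ₗ[R] M →ₛₗ[τ] R) (b : Basis ι R M) : Matrix ι ι R :=
  Matrix.of fun i j => h (b i) (b j)

theorem det_mul_map_det_eq_one (h : M →ₗ[R] M →ₛₗ[τ] R) (b : Basis ι R M)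
    (hb : IsUnit (gram h b).det) {σ : M ≃ₗ[R] M} (hσ : σ ∈ unitaryGroup h) :
    (LinearEquiv.det σ : R) * τ (LinearEquiv.det σ : R) = 1 := by
  let S := LinearMap.toMatrix b b (σ : M →ₗ[R] M)
  have hS : ∀ j, σ (b j) = ∑ i, S i j • b i := fun j => by
    rw [← b.sum_repr (σ (b j))]
    simp [S, LinearMap.toMatrix_apply]
  have hdet : (LinearEquiv.det σ : R) = S.det := by
    rw [LinearEquiv.coe_det, LinearMap.det_toMatrix]
  -- The isometry condition in matrices; the determinant of the Gram matrix then cancels.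
  have hmat : Sᵀ * gram h b * S.map τ = gram h b := by
    ext j l
    have h1 := hσ (b j) (b l)
    rw [hS, hS] at h1
    simp only [map_sum, LinearMap.sum_apply, map_smul, LinearMap.smul_apply, map_smulₛₗ,
      smul_eq_mul] at h1
    change _ = h (b j) (b l)
    rw [← h1]
    simp only [Matrix.mul_apply, Matrix.transpose_apply, Matrix.map_apply, gram, Matrix.of_apply,
      Finset.sum_mul, Finset.mul_sum]
    exact Finset.sum_congr rfl fun i _ => Finset.sum_congr rfl fun k _ => by ring
  have hd := congrArg Matrix.det hmat
  rw [Matrix.det_mul, Matrix.det_mul, Matrix.det_transpose] at hd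
  have hτ : (S.map τ).det = τ S.det := (RingHom.map_det τ S).symm
  rw [hτ] at hd
  rw [hdet]
  apply hb.mul_right_cancel
  rw [one_mul]
  linear_combination hd

end UnitaryDet

/-! ### Local integers and localized ideals. -/

section Local

variable {K : Type*} [Field K] [NumberField K] {conj : K ≃ₐ[ℚ] K} {p : ℕ} [Fact p.Prime]

theorem algebraMap_mem_localInt (r : 𝓞 K) :
    algebraMap K (LocalAlg K p) r ∈ localInt K p := by
  refine ⟨r ⊗ₜ 1, ?_⟩
  simp [Algebra.TensorProduct.algebraMap_apply]

theorem tmul_mem_localInt (r : 𝓞 K) (z : ℤ_[p]) :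
    (r : K) ⊗ₜ[ℚ] (z : ℚ_[p]) ∈ localInt K p := by
  refine ⟨r ⊗ₜ z, ?_⟩
  simp

theorem localInt_induction {P : LocalAlg K p → Prop} (h0 : P 0)
    (hadd : ∀ x y, P x → P y → P (x + y))
    (htmul : ∀ (r : 𝓞 K) (z : ℤ_[p]), P ((r : K) ⊗ₜ[ℚ] (z : ℚ_[p]))) {x : LocalAlg K p}
    (hx : x ∈ localInt K p) : P x := by
  obtain ⟨t, rfl⟩ := hx
  induction t using TensorProduct.induction_on with
  | zero => simpa using h0
  | add s t hs ht =>
    have := hadd _ _ hs ht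
    rwa [← map_add] at this
  | tmul r z => simpa using htmul r z

theorem inv_intCast_mem_localInt {m : ℤ} (hm : ¬ (p : ℤ) ∣ m) :
    algebraMap K (LocalAlg K p) (m : K)⁻¹ ∈ localInt K p := by
  have hu : IsUnit (m : ℤ_[p]) := by
    rw [← not_not (a := IsUnit _), PadicInt.not_isUnit_iff, PadicInt.norm_int_lt_one_iff_dvd]
    exact hm
  obtain ⟨w, hw⟩ := hu.exists_right_inv
  have hw' : (m : ℚ_[p]) * (w : ℚ_[p]) = 1 := by
    exact_mod_cast congrArg (fun z : ℤ_[p] => (z : ℚ_[p])) hw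
  have hm0 : m ≠ 0 := by
    rintro rfl
    exact hm (dvd_zero _)
  have : algebraMap K (LocalAlg K p) (m : K)⁻¹ = ((1 : 𝓞 K) : K) ⊗ₜ[ℚ] (w : ℚ_[p]) := by
    have h1 : (m : LocalAlg K p) * algebraMap K (LocalAlg K p) (m : K)⁻¹ = 1 := by
      rw [← map_intCast (algebraMap K (LocalAlg K p)), ← map_mul,
        mul_inv_cancel₀ (by exact_mod_cast hm0), map_one]
    have h2 : (m : LocalAlg K p) * (((1 : 𝓞 K) : K) ⊗ₜ[ℚ] (w : ℚ_[p])) = 1 := by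
      rw [← map_intCast (Algebra.TensorProduct.includeRight : ℚ_[p] →ₐ[ℚ] LocalAlg K p),
        Algebra.TensorProduct.includeRight_apply, Algebra.TensorProduct.tmul_mul_tmul, hw']
      simp [Algebra.TensorProduct.one_def]
    calc _ = ((m : LocalAlg K p) * (((1 : 𝓞 K) : K) ⊗ₜ[ℚ] (w : ℚ_[p]))) *
          algebraMap K (LocalAlg K p) (m : K)⁻¹ := by rw [h2, one_mul]
      _ = ((m : LocalAlg K p) * algebraMap K (LocalAlg K p) (m : K)⁻¹) *
          (((1 : 𝓞 K) : K) ⊗ₜ[ℚ] (w : ℚ_[p])) := by ring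
      _ = _ := by rw [h1, one_mul]
  rw [this]
  exact tmul_mem_localInt 1 w

variable (p) in
/-- The `𝔬_p`-submodule of `K_p` generated by an `𝔬`-submodule of `K`. -/
def localIdeal (I : Submodule (𝓞 K) K) : Submodule (localInt K p) (LocalAlg K p) :=
  Submodule.span (localInt K p) (algebraMap K (LocalAlg K p) '' (I : Set K))

theorem algebraMap_mem_localIdeal {I : Submodule (𝓞 K) K} {y : K} (hy : y ∈ I) :
    algebraMap K (LocalAlg K p) y ∈ localIdeal p I :=
  Submodule.subset_span ⟨y, hy, rfl⟩

/-- A rational functional that is integral on `I` extends to `K_p` with `p`-integral values on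
`I_p`. This is applied to the coordinates for a `ℤ`-basis of `I`. -/
theorem norm_lift_le_one {I : Submodule (𝓞 K) K} {φ : K →ₗ[ℚ] ℚ}
    (hφ : ∀ y ∈ I, ∃ m : ℤ, (m : ℚ) = φ y) {x : LocalAlg K p} (hx : x ∈ localIdeal p I) :
    ‖TensorProduct.lift ((LinearMap.lsmul ℚ ℚ_[p]).comp φ) x‖ ≤ 1 := by
  -- The functional is not `𝔬_p`-linear, so the induction must carry all `𝔬_p`-multiples.
  suffices H : ∀ c ∈ localInt K p,
      ‖TensorProduct.lift ((LinearMap.lsmul ℚ ℚ_[p]).comp φ) (c * x)‖ ≤ 1 by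
    simpa using H 1 (one_mem _)
  have hadd : ∀ x y : LocalAlg K p,
      ‖TensorProduct.lift ((LinearMap.lsmul ℚ ℚ_[p]).comp φ) x‖ ≤ 1 →
      ‖TensorProduct.lift ((LinearMap.lsmul ℚ ℚ_[p]).comp φ) y‖ ≤ 1 →
      ‖TensorProduct.lift ((LinearMap.lsmul ℚ ℚ_[p]).comp φ) (x + y)‖ ≤ 1 := by
    intro x y hx hy
    rw [map_add]
    exact (Padic.nonarchimedean _ _).trans (max_le hx hy)
  induction hx using Submodule.span_induction with
  | zero => simp
  | add x y _ _ hx hy =>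
    intro c hc
    rw [mul_add]
    exact hadd _ _ (hx c hc) (hy c hc)
  | smul c' x _ hx =>
    intro c hc
    rw [Subalgebra.smul_def, smul_eq_mul, ← mul_assoc]
    exact hx _ (mul_mem hc c'.2)
  | mem x hx =>
    obtain ⟨y, hy, rfl⟩ := hx
    intro c hc
    refine localInt_induction (P := fun c => ‖TensorProduct.lift
      ((LinearMap.lsmul ℚ ℚ_[p]).comp φ) (c * algebraMap K (LocalAlg K p) y)‖ ≤ 1)
      (by simp) (fun x z hx hz => by rw [add_mul]; exact hadd _ _ hx hz) (fun r z => ?_) hc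
    obtain ⟨m, hm⟩ := hφ _ (I.smul_mem r hy)
    rw [Algebra.TensorProduct.algebraMap_apply, Algebra.TensorProduct.tmul_mul_tmul, mul_one,
      TensorProduct.lift.tmul, LinearMap.comp_apply]
    have : φ ((r : K) * algebraMap K K y) = m := by
      rw [hm, Algebra.smul_def]
      rfl
    rw [this, LinearMap.lsmul_apply, Algebra.smul_def, norm_mul]
    refine mul_le_one₀ ?_ (norm_nonneg _) z.norm_le_one
    simpa using Padic.norm_int_le_one m

/-- The coordinates of `y` for a `ℤ`-basis of `I` are rationals integral at every prime. -/
theorem mem_of_forall_mem_localIdeal (I : (FractionalIdeal (𝓞 K)⁰ K)ˣ) {y : K}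
    (hy : ∀ (p : ℕ) [Fact p.Prime], algebraMap K (LocalAlg K p) y ∈
      localIdeal p ((I : FractionalIdeal (𝓞 K)⁰ K) : Submodule (𝓞 K) K)) :
    y ∈ (I : FractionalIdeal (𝓞 K)⁰ K) := by
  let e := basisOfFractionalIdeal K I
  have hqint : ∀ i, ∃ m : ℤ, (m : ℚ) = e.repr y i := by
    intro i
    apply Rat.exists_int_eq_of_norm_le_one
    intro p _
    have := norm_lift_le_one (φ := e.coord i) (fun z hz => ?_) (hy p)
    · rw [Algebra.TensorProduct.algebraMap_apply] at this
      simpa [Algebra.smul_def] using this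
    · have hz' : z ∈ Submodule.span ℤ (Set.range e) := (mem_span_basisOfFractionalIdeal K).mpr hz
      obtain ⟨m, hm⟩ := (e.mem_span_iff_repr_mem ℤ z).mp hz' i
      exact ⟨m, hm⟩
  have : y ∈ Submodule.span ℤ (Set.range e) := (e.mem_span_iff_repr_mem ℤ y).mpr fun i => by
    obtain ⟨m, hm⟩ := hqint i
    exact ⟨m, hm⟩
  exact (mem_span_basisOfFractionalIdeal K).mp this

/-- Multiply `w I ⊆ I_p` by `I⁻¹` and use `I * I⁻¹ = 1`. -/
theorem mem_localInt_of_mul_mem (I : (FractionalIdeal (𝓞 K)⁰ K)ˣ) {w : LocalAlg K p}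
    (hw : ∀ y ∈ (I : FractionalIdeal (𝓞 K)⁰ K), w * algebraMap K (LocalAlg K p) y ∈
      localIdeal p ((I : FractionalIdeal (𝓞 K)⁰ K) : Submodule (𝓞 K) K)) : w ∈ localInt K p := by
  have hβ : ∀ β ∈ (I : FractionalIdeal (𝓞 K)⁰ K)⁻¹, ∀ z ∈
      localIdeal p ((I : FractionalIdeal (𝓞 K)⁰ K) : Submodule (𝓞 K) K),
      z * algebraMap K (LocalAlg K p) β ∈ localInt K p := by
    intro β hβ z hz
    induction hz using Submodule.span_induction with
    | zero => rw [zero_mul]; exact zero_mem _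
    | add x y _ _ hx hy => rw [add_mul]; exact add_mem hx hy
    | smul c x _ hx =>
      rw [Subalgebra.smul_def, smul_mul_assoc]
      exact mul_mem c.2 hx
    | mem x hx =>
      obtain ⟨y, hy, rfl⟩ := hx
      obtain ⟨t, ht⟩ := (FractionalIdeal.mem_one_iff _).mp
        ((FractionalIdeal.mem_inv_iff I.ne_zero).mp hβ y hy)
      rw [← map_mul, mul_comm, ← ht]
      exact algebraMap_mem_localInt t
  have key : ∀ t ∈ (I : FractionalIdeal (𝓞 K)⁰ K) * (I : FractionalIdeal (𝓞 K)⁰ K)⁻¹,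
      w * algebraMap K (LocalAlg K p) t ∈ localInt K p := by
    intro t ht
    rw [← FractionalIdeal.mem_coe, FractionalIdeal.coe_mul] at ht
    induction ht using Submodule.mul_induction_on' with
    | mem_mul_mem r hr b hb =>
      rw [map_mul, ← mul_assoc]
      exact hβ b hb _ (hw r hr)
    | add x _ y _ hx hy =>
      rw [map_add, mul_add]
      exact add_mem hx hy
  have := key 1 (by rw [mul_inv_cancel₀ I.ne_zero]; exact FractionalIdeal.one_mem_one _)
  rwa [map_one, mul_one] at this

variable {V : Type*} [AddCommGroup V] [Module K V] [Module (𝓞 K) V] [IsScalarTower (𝓞 K) K V]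
  {ι : Type*} [Fintype ι] [DecidableEq ι]

theorem det_basis_tmul {R A M : Type*} [CommRing R] [CommRing A] [Algebra R A] [AddCommGroup M]
    [Module R M] (b : Basis ι R M) (v : ι → M) :
    (Algebra.TensorProduct.basis A b).det (fun i => (1 : A) ⊗ₜ[R] v i) =
      algebraMap R A (b.det v) := by
  rw [Basis.det_apply, Basis.det_apply, RingHom.map_det]
  congr 1
  ext i j
  simp [Basis.toMatrix_apply]

/-- Vectors of `N` are images under `σ` of vectors of `L_p`, so their determinants are `det σ` times
determinants from `L_p`. By multilinearity the latter lie in the localized determinant module of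
`L`. -/
theorem inv_det_mul_mem_localIdeal (b : Basis ι K V) {L N : Submodule (𝓞 K) V}
    {σ : LocalSpace K p V ≃ₗ[LocalAlg K p] LocalSpace K p V}
    (hσ : (localLattice N p : Set (LocalSpace K p V)) = σ '' (localLattice L p : Set _)) {y : K}
    (hy : y ∈ detIdeal b N) :
    (((LinearEquiv.det σ)⁻¹ : (LocalAlg K p)ˣ) : LocalAlg K p) * algebraMap K (LocalAlg K p) y ∈
      localIdeal p (detIdeal b L) := by
  induction hy using Submodule.span_induction with
  | zero => simp
  | add x y _ _ hx hy => rw [map_add, mul_add]; exact Submodule.add_mem _ hx hy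
  | smul c x _ hx =>
    rw [Algebra.smul_def, map_mul, mul_left_comm]
    exact Submodule.smul_mem _ (⟨_, algebraMap_mem_localInt c⟩ : localInt K p) hx
  | mem x hx =>
    obtain ⟨v, hv, rfl⟩ := hx
    have hmem : ∀ i, (1 : LocalAlg K p) ⊗ₜ[K] v i ∈ σ '' (localLattice L p : Set _) := fun i => by
      rw [← hσ]
      exact Submodule.subset_span ⟨v i, hv i, rfl⟩
    choose w hw hwv using hmem
    have hdet : algebraMap K (LocalAlg K p) (b.det v) =
        LinearEquiv.det σ * (Algebra.TensorProduct.basis (LocalAlg K p) b).det w := by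
      rw [← det_basis_tmul, LinearEquiv.coe_det, ← Basis.det_comp]
      congr 1
      ext i
      exact (hwv i).symm
    rw [hdet, Units.inv_mul_cancel_left]
    refine map_mem_of_forall_mem_span (R := localInt K p)
      (Algebra.TensorProduct.basis (LocalAlg K p) b).det.toMultilinearMap ?_ hw
    intro u hu
    choose u' hu' hu'' using hu
    have : u = fun i => (1 : LocalAlg K p) ⊗ₜ[K] u' i := by
      ext i
      exact (hu'' i).symm
    rw [this]
    change (Algebra.TensorProduct.basis (LocalAlg K p) b).det _ ∈ _
    rw [det_basis_tmul]
    exact algebraMap_mem_localIdeal (Submodule.subset_span ⟨u', hu', rfl⟩)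

end Local

/-! ### Comparison of two orbit counts. -/

section Classes

universe v

/-- Used with `f` the special class on the special genus `A` and `g` the isometry class on the
partial genus `B`. -/
theorem _root_.Cardinal.mk_image_eq_mk_image {α : Type*} {β γ : Type v} (f : α → β) (g : α → γ)
    {A B : Set α} (hAB : A ⊆ B) (hB : ∀ b ∈ B, ∃ a ∈ A, g a = g b)
    (hfg : ∀ a ∈ A, ∀ a' ∈ A, f a = f a' ↔ g a = g a') :
    Cardinal.mk (f '' A) = Cardinal.mk (g '' B) := by
  choose r hrA hr using fun y : f '' A => y.2
  refine Cardinal.mk_congr (Equiv.ofBijective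
    (fun y => (⟨g (r y), r y, hAB (hrA y), rfl⟩ : g '' B)) ⟨fun y z hyz => ?_, ?_⟩)
  · have hyz' : g (r y) = g (r z) := congrArg Subtype.val hyz
    ext
    rw [← hr y, ← hr z]
    exact (hfg _ (hrA y) _ (hrA z)).mpr hyz'
  · rintro ⟨_, b, hb, rfl⟩
    obtain ⟨a, ha, hab⟩ := hB b hb
    refine ⟨⟨f a, a, ha, rfl⟩, Subtype.ext ?_⟩
    change g (r ⟨f a, a, ha, rfl⟩) = g b
    rw [← hab]
    exact (hfg _ (hrA _) _ ha).mp (hr _)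

end Classes

/-! ### Passage between local and global isometries. -/

section Global

variable {K : Type*} [Field K] [NumberField K] {conj : K ≃ₐ[ℚ] K}
  {V : Type*} [AddCommGroup V] [Module K V] [Module (𝓞 K) V] [IsScalarTower (𝓞 K) K V]

/-- Two lattices in the same orbit of a group of automorphisms of `V` have the same orbit. -/
theorem setOf_image_eq_of_image_eq {G : Subgroup (V ≃ₗ[K] V)} {σ : V ≃ₗ[K] V} (hσ : σ ∈ G)
    {L N : Submodule (𝓞 K) V} (hN : (N : Set V) = σ '' (L : Set V)) :
    {X : Submodule (𝓞 K) V | ∃ ρ ∈ G, (X : Set V) = ρ '' (N : Set V)} =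
      {X : Submodule (𝓞 K) V | ∃ ρ ∈ G, (X : Set V) = ρ '' (L : Set V)} := by
  ext X
  constructor
  · rintro ⟨ρ, hρ, hX⟩
    refine ⟨ρ * σ, G.mul_mem hρ hσ, ?_⟩
    rw [hX, hN, Set.image_image]
    rfl
  · rintro ⟨ρ, hρ, hX⟩
    refine ⟨ρ * σ⁻¹, G.mul_mem hρ (G.inv_mem hσ), ?_⟩
    rw [hX, hN, Set.image_image]
    refine Set.image_congr fun v _ => ?_
    change ρ v = ρ (σ.symm (σ v))
    rw [σ.symm_apply_apply]

theorem isLattice_map {N : Submodule (𝓞 K) V} (hN : N.IsLattice K) (σ : V ≃ₗ[K] V) :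
    (N.map ((σ : V →ₗ[K] V).restrictScalars (𝓞 K))).IsLattice K := by
  refine ⟨hN.fg.map _, ?_⟩
  have : ((N.map ((σ : V →ₗ[K] V).restrictScalars (𝓞 K)) : Submodule (𝓞 K) V) : Set V) =
      (σ : V →ₗ[K] V) '' (N : Set V) := rfl
  rw [this, ← Submodule.map_span, hN.span_eq_top, Submodule.map_top, LinearEquiv.range]

/-- Composing with `-1` preserves `L` and, in odd dimension, changes the sign of the determinant. -/
theorem exists_special_image_eq {h : V →ₗ[K] V →ₛₗ[(conj : K →+* K)] K}
    (hn : Odd (finrank K V)) {σ : V ≃ₗ[K] V}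
    (hσ : σ ∈ unitaryGroup h) (hdet : LinearEquiv.det σ = 1 ∨ LinearEquiv.det σ = -1)
    {L N : Submodule (𝓞 K) V} (hN : (N : Set V) = σ '' (L : Set V)) :
    ∃ ρ ∈ specialUnitaryGroup h, (N : Set V) = ρ '' (L : Set V) := by
  rcases hdet with hdet | hdet
  · exact ⟨σ, ⟨hσ, hdet⟩, hN⟩
  · refine ⟨σ * LinearEquiv.neg K, ⟨?_, ?_⟩, ?_⟩
    · intro v w
      change h (σ (-v)) (σ (-w)) = h v w
      rw [hσ]
      simp
    · change LinearEquiv.det _ = 1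
      rw [map_mul, hdet]
      ext
      have : ((LinearEquiv.neg K : V ≃ₗ[K] V) : V →ₗ[K] V) = (-1 : K) • LinearMap.id := by
        ext v
        simp
      rw [Units.val_mul, LinearEquiv.coe_det, this, LinearMap.det_smul, hn.neg_one_pow]
      simp
    · rw [hN]
      ext v
      constructor
      · rintro ⟨l, hl, rfl⟩
        exact ⟨-l, L.neg_mem hl, by simp⟩
      · rintro ⟨l, hl, rfl⟩
        exact ⟨-l, L.neg_mem hl, by simp⟩

variable {ι : Type*} [Fintype ι] [DecidableEq ι]

theorem detIdeal_image (b : Basis ι K V) {σ : V ≃ₗ[K] V} {L N : Submodule (𝓞 K) V}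
    (hN : (N : Set V) = σ '' (L : Set V)) :
    detIdeal b N =
      (detIdeal b L).map (LinearMap.mulLeft (𝓞 K) (LinearEquiv.det σ : K)) := by
  rw [detIdeal, detIdeal, Submodule.map_span]
  congr 1
  have hb : ∀ v : ι → V, b.det (σ ∘ v) = (LinearEquiv.det σ : K) * b.det v := fun v => by
    rw [LinearEquiv.coe_det]
    exact b.det_comp (σ : V →ₗ[K] V) v
  ext y
  constructor
  · rintro ⟨v, hv, rfl⟩
    have hv' : ∀ i, v i ∈ σ '' (L : Set V) := fun i => hN ▸ hv i
    choose w hw hwv using hv'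
    refine ⟨_, ⟨w, hw, rfl⟩, ?_⟩
    rw [LinearMap.mulLeft_apply, ← hb]
    congr 1
    exact funext hwv
  · rintro ⟨_, ⟨v, hv, rfl⟩, rfl⟩
    refine ⟨σ ∘ v, fun i => ?_, hb v⟩
    change σ (v i) ∈ (N : Set V)
    rw [hN]
    exact ⟨v i, hv i, rfl⟩

/-- Cancelling the invertible `I` leaves `(d) = 1`, so both `d` and `d⁻¹` are integral. -/
theorem exists_unit_eq_of_map_eq {I : (FractionalIdeal (𝓞 K)⁰ K)ˣ} {d : Kˣ}
    (hd : ((I : FractionalIdeal (𝓞 K)⁰ K) : Submodule (𝓞 K) K).map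
      (LinearMap.mulLeft (𝓞 K) (d : K)) = (I : FractionalIdeal (𝓞 K)⁰ K)) :
    ∃ u : (𝓞 K)ˣ, ((u : 𝓞 K) : K) = d := by
  have h1 : toPrincipalIdeal (𝓞 K) K d * I = I := by
    ext1
    apply FractionalIdeal.coeToSubmodule_injective
    refine Eq.trans ?_ hd
    ext y
    change y ∈ ((toPrincipalIdeal (𝓞 K) K d * I : (FractionalIdeal (𝓞 K)⁰ K)ˣ) :
      FractionalIdeal (𝓞 K)⁰ K) ↔ _
    rw [Units.val_mul, coe_toPrincipalIdeal, FractionalIdeal.mem_singleton_mul,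
      Submodule.mem_map]
    simp only [FractionalIdeal.mem_coe, LinearMap.mulLeft_apply]
    exact exists_congr fun z => and_congr_right fun _ => eq_comm
  have h2 : toPrincipalIdeal (𝓞 K) K d = 1 := mul_eq_right.mp h1
  have key : ∀ e : Kˣ, toPrincipalIdeal (𝓞 K) K e = 1 → ∃ r : 𝓞 K, (r : K) = e := by
    intro e he
    have := congrArg (fun J : (FractionalIdeal (𝓞 K)⁰ K)ˣ => (J : FractionalIdeal (𝓞 K)⁰ K)) he
    simp only [coe_toPrincipalIdeal, Units.val_one] at this
    have hmem := FractionalIdeal.mem_spanSingleton_self (𝓞 K)⁰ (e : K)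
    rw [this] at hmem
    exact (FractionalIdeal.mem_one_iff _).mp hmem
  obtain ⟨r, hr⟩ := key d h2
  obtain ⟨s, hs⟩ := key d⁻¹ (by rw [map_inv, h2, inv_one])
  have hrs : r * s = 1 := by
    apply FaithfulSMul.algebraMap_injective (𝓞 K) K
    rw [map_mul, map_one]
    change (r : K) * (s : K) = 1
    rw [hr, hs, Units.mul_inv]
  exact ⟨⟨r, s, hrs, by rw [mul_comm, hrs]⟩, hr⟩

theorem detIdeal_le_of_local [FiniteDimensional K V] (b : Basis (Fin (finrank K V)) K V)
    {L N : Submodule (𝓞 K) V} (hL : L.IsLattice K)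
    (hN : ∀ (p : ℕ) [Fact p.Prime], ∃ σ : LocalSpace K p V ≃ₗ[LocalAlg K p] LocalSpace K p V,
      LinearEquiv.det σ = 1 ∧
        (localLattice N p : Set (LocalSpace K p V)) = σ '' (localLattice L p : Set _)) :
    detIdeal b N ≤ detIdeal b L := by
  intro y hy
  obtain ⟨I, hI, -⟩ := exists_eq_detIdeal hL b
  rw [hI]
  refine mem_of_forall_mem_localIdeal I fun p _ => ?_
  obtain ⟨σ, hσ, hNσ⟩ := hN p
  have := inv_det_mul_mem_localIdeal b hNσ hy
  rwa [hσ, inv_one, Units.val_one, one_mul, hI] at this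

theorem _root_.LinearEquiv.eq_symm_image_of_eq_image {R M : Type*} [Semiring R] [AddCommMonoid M]
    [Module R M] (σ : M ≃ₗ[R] M) {S T : Set M} (h : T = σ '' S) : S = σ.symm '' T := by
  rw [h, Set.image_image]
  simp

theorem detIdeal_eq_of_mem_specialGenus [FiniteDimensional K V]
    (b : Basis (Fin (finrank K V)) K V) {h : V →ₗ[K] V →ₛₗ[(conj : K →+* K)] K}
    {L N : Submodule (𝓞 K) V} (hL : L.IsLattice K) (hN : N ∈ specialGenus h L) :
    detIdeal b N = detIdeal b L := by
  apply le_antisymm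
  · refine detIdeal_le_of_local b hL fun p _ => ?_
    obtain ⟨σ, hσ, hNσ⟩ := hN.2 p
    exact ⟨σ, hσ.2, hNσ⟩
  · refine detIdeal_le_of_local b hN.1 fun p _ => ?_
    obtain ⟨σ, hσ, hNσ⟩ := hN.2 p
    refine ⟨σ.symm, ?_, σ.eq_symm_image_of_eq_image hNσ⟩
    have : LinearEquiv.det σ = 1 := hσ.2
    change LinearEquiv.det σ⁻¹ = 1
    rw [map_inv, this, inv_one]

theorem not_finite_ringOfIntegers : ¬ Module.Finite (𝓞 K) K := by
  intro hfin
  have : Algebra.IsIntegral (𝓞 K) K := inferInstance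
  exact RingOfIntegers.not_isField K (isField_of_isIntegral_of_isField
    (FaithfulSMul.algebraMap_injective (𝓞 K) K) (Field.toIsField K))

/-- The form on a space with a unimodular lattice is nondegenerate. -/
theorem eq_zero_of_forall_form_eq_zero {h : V →ₗ[K] V →ₛₗ[(conj : K →+* K)] K}
    {L : Submodule (𝓞 K) V} (hL : IsUnimodular h L) {w : V} (hw : ∀ v, h w v = 0) : w = 0 := by
  by_contra hw0
  have : Module.Finite (𝓞 K) L := Module.Finite.iff_fg.mpr hL.1.fg
  -- The line through a radical vector `w` lies in the dual, hence in the finitely generated `L`;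
  -- this would make `K` finite over `𝓞 K`.
  let f : K →ₗ[𝓞 K] L := LinearMap.codRestrict L
    ((LinearMap.toSpanSingleton K V w).restrictScalars (𝓞 K)) fun c => by
      rw [← hL.2]
      intro y _
      refine ⟨0, ?_⟩
      simp [hw]
  have hf : Function.Injective f := by
    intro c c' hcc
    have : c • w = c' • w := congrArg Subtype.val hcc
    exact smul_left_injective K hw0 this
  exact not_finite_ringOfIntegers (Module.Finite.of_injective f hf)

theorem det_gram_ne_zero {h : V →ₗ[K] V →ₛₗ[(conj : K →+* K)] K}
    {L : Submodule (𝓞 K) V} (hL : IsUnimodular h L) (b : Basis ι K V) : (gram h b).det ≠ 0 := by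
  intro h0
  obtain ⟨c, hc0, hc⟩ := Matrix.exists_vecMul_eq_zero_iff.mpr h0
  apply hc0
  have hw : ∑ i, c i • b i = 0 := by
    refine eq_zero_of_forall_form_eq_zero hL fun v => ?_
    rw [← b.sum_repr v, map_sum]
    refine Finset.sum_eq_zero fun j _ => ?_
    rw [map_smulₛₗ]
    have := congrFun hc j
    simp only [Matrix.vecMul, dotProduct, gram, Matrix.of_apply, Pi.zero_apply] at this
    rw [map_sum, LinearMap.sum_apply]
    simp only [map_smul, LinearMap.smul_apply, smul_eq_mul]
    rw [this, mul_zero]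
  ext i
  have : b.repr (∑ i, c i • b i) i = 0 := by rw [hw]; simp
  rwa [b.repr_sum_self] at this

variable {p : ℕ} [Fact p.Prime]

theorem isUnit_det_gram_localForm {h : V →ₗ[K] V →ₛₗ[(conj : K →+* K)] K}
    {L : Submodule (𝓞 K) V} (hL : IsUnimodular h L) (b : Basis ι K V) :
    IsUnit (gram (localForm h p) (Algebra.TensorProduct.basis (LocalAlg K p) b)).det := by
  have : gram (localForm h p) (Algebra.TensorProduct.basis (LocalAlg K p) b) =
      (gram h b).map (algebraMap K (LocalAlg K p)) := by
    ext i j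
    simp [gram, localForm, extendForm_tmul]
  rw [this]
  have h2 : ((gram h b).map (algebraMap K (LocalAlg K p))).det =
      algebraMap K (LocalAlg K p) (gram h b).det := (RingHom.map_det _ _).symm
  rw [h2]
  exact (isUnit_iff_ne_zero.mpr (det_gram_ne_zero hL b)).map _

theorem baseChange_mem_unitaryGroup {h : V →ₗ[K] V →ₛₗ[(conj : K →+* K)] K} {σ : V ≃ₗ[K] V}
    (hσ : σ ∈ unitaryGroup h) :
    σ.baseChange K (LocalAlg K p) V V ∈ unitaryGroup (localForm h p) := by
  intro x y
  induction x using TensorProduct.induction_on with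
  | zero => simp
  | add x x' hx hx' => simp only [map_add, LinearMap.add_apply, hx, hx']
  | tmul a v =>
    induction y using TensorProduct.induction_on with
    | zero => simp
    | add y y' hy hy' => simp only [map_add, hy, hy']
    | tmul b w =>
      rw [LinearEquiv.baseChange_tmul, LinearEquiv.baseChange_tmul, localForm, extendForm_tmul,
        extendForm_tmul, hσ]

theorem localLattice_image {σ : V ≃ₗ[K] V} {L N : Submodule (𝓞 K) V}
    (hN : (N : Set V) = σ '' (L : Set V)) :
    (localLattice N p : Set (LocalSpace K p V)) =
      σ.baseChange K (LocalAlg K p) V V '' (localLattice L p : Set _) := by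
  have h1 : localLattice N p = (localLattice L p).map
      ((σ.baseChange K (LocalAlg K p) V V : LocalSpace K p V →ₗ[LocalAlg K p]
        LocalSpace K p V).restrictScalars (localInt K p)) := by
    rw [localLattice, localLattice, Submodule.map_span, hN, Set.image_image, Set.image_image]
    congr 1
  rw [h1]
  rfl

theorem localConj_mem_localInt {w : LocalAlg K p} (hw : w ∈ localInt K p) :
    localConj p conj w ∈ localInt K p := by
  refine localInt_induction (P := fun w => localConj p conj w ∈ localInt K p)
    (by rw [map_zero]; exact zero_mem _)
    (fun x y hx hy => by rw [map_add]; exact add_mem hx hy) (fun r z => ?_) hw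
  have hr : IsIntegral ℤ (conj (r : K)) := r.isIntegral_coe.map conj
  have : localConj p conj ((r : K) ⊗ₜ[ℚ] (z : ℚ_[p])) =
      (((⟨conj (r : K), hr⟩ : 𝓞 K) : 𝓞 K) : K) ⊗ₜ[ℚ] (z : ℚ_[p]) := rfl
  rw [this]
  exact tmul_mem_localInt (⟨conj (r : K), hr⟩ : 𝓞 K) z

theorem localForm_mem_localInt {h : V →ₗ[K] V →ₛₗ[(conj : K →+* K)] K}
    {L : Submodule (𝓞 K) V} (hd : dual h L = L) {x : V} (hx : x ∈ L) {v : LocalSpace K p V}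
    (hv : v ∈ localLattice L p) :
    localForm h p v ((1 : LocalAlg K p) ⊗ₜ[K] x) ∈ localInt K p := by
  induction hv using Submodule.span_induction with
  | zero => rw [map_zero, LinearMap.zero_apply]; exact zero_mem _
  | add v w _ _ hv hw => rw [map_add, LinearMap.add_apply]; exact add_mem hv hw
  | smul c v _ hv =>
    rw [Subalgebra.smul_def, map_smul, LinearMap.smul_apply, smul_eq_mul]
    exact mul_mem c.2 hv
  | mem v hv =>
    obtain ⟨y, hy, rfl⟩ := hv
    obtain ⟨r, hr⟩ := exists_eq_form_of_dual_eq hd hy hx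
    simp only [localForm, extendForm_tmul, map_one, mul_one, one_mul, ← hr]
    exact algebraMap_mem_localInt r

/-- A unimodular lattice of odd rank has local automorphisms of every determinant that is an
integral unit of norm one. -/
theorem exists_local_automorphism_det [FiniteDimensional K V]
    {h : V →ₗ[K] V →ₛₗ[(conj : K →+* K)] K} (hh : IsHermitian h)
    {L : Submodule (𝓞 K) V} (hd : dual h L = L) {x : V} (hx : x ∈ L) {m : ℤ}
    (hm : (m : K) = h x x) (hpm : ¬ (p : ℤ) ∣ m) (u : (LocalAlg K p)ˣ)
    (hu : (u : LocalAlg K p) ∈ localInt K p)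
    (hu' : ((u⁻¹ : (LocalAlg K p)ˣ) : LocalAlg K p) ∈ localInt K p)
    (hnorm : (u : LocalAlg K p) * localConj p conj u = 1) :
    ∃ ρ ∈ unitaryGroup (localForm h p), LinearEquiv.det ρ = u ∧
      (localLattice L p : Set (LocalSpace K p V)) = ρ '' (localLattice L p : Set _) := by
  have hx' : ∀ w, localForm h p ((1 : LocalAlg K p) ⊗ₜ[K] x) w =
      localConj p conj (localForm h p w ((1 : LocalAlg K p) ⊗ₜ[K] x)) := by
    intro w
    induction w using TensorProduct.induction_on with
    | zero => simp
    | add v w hv hw => simp only [map_add, LinearMap.add_apply, hv, hw]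
    | tmul a v =>
      simp only [localForm, extendForm_tmul, map_one, mul_one, one_mul, map_mul,
        localConj_algebraMap]
      rw [hh x v]
  have hm0 : (m : K) ≠ 0 := by
    have : m ≠ 0 := by
      rintro rfl
      exact hpm (dvd_zero _)
    exact_mod_cast this
  have hc : algebraMap K (LocalAlg K p) (m : K)⁻¹ *
      localForm h p ((1 : LocalAlg K p) ⊗ₜ[K] x) ((1 : LocalAlg K p) ⊗ₜ[K] x) = 1 := by
    rw [localForm, extendForm_tmul, map_one, one_mul, one_mul, ← hm, ← map_mul,
      inv_mul_cancel₀ hm0, map_one]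
  obtain ⟨ρ, hρ, hdet, hρv, hρs⟩ := exists_quasiReflection (localForm h p) hx' hc u hnorm
  -- The coefficient of `x` is integral because `m` is a local unit. The cases `e = u` and `e = u⁻¹`
  -- give both inclusions.
  have hmem : ∀ e ∈ localInt K p, ∀ v ∈ localLattice L p,
      v + ((e - 1) * algebraMap K (LocalAlg K p) (m : K)⁻¹ *
        localForm h p v ((1 : LocalAlg K p) ⊗ₜ[K] x)) • ((1 : LocalAlg K p) ⊗ₜ[K] x) ∈
        localLattice L p := by
    intro e he v hv
    refine Submodule.add_mem _ hv ?_
    refine Submodule.smul_mem _ (⟨_, mul_mem (mul_mem (sub_mem he (one_mem _))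
      (inv_intCast_mem_localInt hpm)) (localForm_mem_localInt hd hx hv)⟩ : localInt K p) ?_
    exact Submodule.subset_span ⟨x, hx, rfl⟩
  refine ⟨ρ, hρ, hdet, ?_⟩
  ext v
  constructor
  · intro hv
    refine ⟨ρ.symm v, ?_, ρ.apply_symm_apply v⟩
    rw [hρs]
    exact hmem _ hu' v hv
  · rintro ⟨v, hv, rfl⟩
    rw [hρv]
    exact hmem _ hu v hv

/-- Multiplication by `d / det σ` maps the determinant module of `L` into its localization. With the
inverse situation this makes `d / det σ` a local unit. -/
theorem inv_det_mul_mem_localInt [FiniteDimensional K V] (b : Basis (Fin (finrank K V)) K V)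
    {L N : Submodule (𝓞 K) V} (hL : L.IsLattice K)
    {σ : LocalSpace K p V ≃ₗ[LocalAlg K p] LocalSpace K p V}
    (hσ : (localLattice N p : Set (LocalSpace K p V)) = σ '' (localLattice L p : Set _)) {d : K}
    (hd : ∀ y ∈ detIdeal b L, d * y ∈ detIdeal b N) :
    (((LinearEquiv.det σ)⁻¹ : (LocalAlg K p)ˣ) : LocalAlg K p) * algebraMap K (LocalAlg K p) d ∈
      localInt K p := by
  obtain ⟨I, hI, -⟩ := exists_eq_detIdeal hL b
  refine mem_localInt_of_mul_mem I fun y hy => ?_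
  have hy' : y ∈ detIdeal b L := by rw [hI]; exact hy
  have := inv_det_mul_mem_localIdeal b hσ (hd y hy')
  rwa [map_mul, ← mul_assoc, hI] at this

theorem exists_int_eq_of_forall_mem_localInt {e : K}
    (he : ∀ (p : ℕ) [Fact p.Prime], algebraMap K (LocalAlg K p) e ∈ localInt K p) :
    ∃ r : 𝓞 K, (r : K) = e := by
  have := mem_of_forall_mem_localIdeal (1 : (FractionalIdeal (𝓞 K)⁰ K)ˣ) (y := e) fun p _ => by
    have h1 : algebraMap K (LocalAlg K p) (1 : K) ∈ localIdeal p
        (((1 : (FractionalIdeal (𝓞 K)⁰ K)ˣ) : FractionalIdeal (𝓞 K)⁰ K) : Submodule (𝓞 K) K) :=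
      algebraMap_mem_localIdeal (FractionalIdeal.one_mem_one _)
    have h2 := Submodule.smul_mem _ (⟨_, he p⟩ : localInt K p) h1
    rwa [Subalgebra.smul_def, smul_eq_mul, map_one, mul_one] at h2
  exact (FractionalIdeal.mem_one_iff _).mp this

/-- The scaling factor between the determinant modules of two lattices of the same genus and
Steinitz class has norm one. -/
theorem mul_conj_eq_one_of_mem_genus [FiniteDimensional K V] (hK : finrank ℚ K = 2)
    [IsTotallyComplex K] (hd₃ : discr K ≠ -3) (hd₄ : discr K ≠ -4) (hconj : conj ≠ 1)
    {h : V →ₗ[K] V →ₛₗ[(conj : K →+* K)] K} {L N : Submodule (𝓞 K) V} (hL : IsUnimodular h L)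
    (hN : N ∈ genus h L) (b : Basis (Fin (finrank K V)) K V) {d : Kˣ}
    (hd : ∀ y ∈ detIdeal b L, (d : K) * y ∈ detIdeal b N)
    (hd' : ∀ y ∈ detIdeal b N, ((d⁻¹ : Kˣ) : K) * y ∈ detIdeal b L) :
    (d : K) * conj d = 1 := by
  -- If `w` has norm one, then `w * e` and `e` have the same norm, which is integral as soon as `w *
  -- e` is.
  have key : ∀ (e : K) (p : ℕ) [Fact p.Prime] (w : LocalAlg K p), w * localConj p conj w = 1 →
      w * algebraMap K (LocalAlg K p) e ∈ localInt K p →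
      algebraMap K (LocalAlg K p) (e * conj e) ∈ localInt K p := by
    intro e p _ w hw hwe
    have h1 := mul_mem hwe (localConj_mem_localInt (conj := conj) hwe)
    rw [map_mul, localConj_algebraMap] at h1
    have h2 : w * algebraMap K (LocalAlg K p) e *
        (localConj p conj w * algebraMap K (LocalAlg K p) ((conj : K →+* K) e)) =
        algebraMap K (LocalAlg K p) (e * conj e) := by
      rw [map_mul]
      change _ = algebraMap K (LocalAlg K p) e * algebraMap K (LocalAlg K p) ((conj : K →+* K) e)
      linear_combination (algebraMap K (LocalAlg K p) e *
        algebraMap K (LocalAlg K p) ((conj : K →+* K) e)) * hw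
    rwa [h2] at h1
  obtain ⟨r, hr⟩ := exists_int_eq_of_forall_mem_localInt (e := (d : K) * conj d) fun p _ => by
    obtain ⟨σ, hσ, hNσ⟩ := hN.2 p
    refine key _ p _ ?_ (inv_det_mul_mem_localInt b hL.1 hNσ hd)
    have := det_mul_map_det_eq_one _ _ (isUnit_det_gram_localForm hL b) (inv_mem hσ)
    rwa [map_inv] at this
  obtain ⟨s, hs⟩ := exists_int_eq_of_forall_mem_localInt
      (e := ((d⁻¹ : Kˣ) : K) * conj ((d⁻¹ : Kˣ) : K)) fun p _ => by
    obtain ⟨σ, hσ, hNσ⟩ := hN.2 p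
    refine key _ p _ ?_ (inv_det_mul_mem_localInt b hN.1 (σ.eq_symm_image_of_eq_image hNσ) hd')
    have := det_mul_map_det_eq_one _ _ (isUnit_det_gram_localForm hL b) hσ
    have h2 : (LinearEquiv.det σ.symm)⁻¹ = LinearEquiv.det σ := by
      change (LinearEquiv.det σ⁻¹)⁻¹ = _
      rw [map_inv, inv_inv]
    rwa [h2]
  have hrs : r * s = 1 := by
    apply FaithfulSMul.algebraMap_injective (𝓞 K) K
    rw [map_mul, map_one]
    change (r : K) * (s : K) = 1
    rw [hr, hs, mul_mul_mul_comm, ← map_mul, Units.mul_inv, map_one, one_mul]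
  exact mul_conj_eq_one hK hd₃ hd₄ hconj (u := ⟨r, s, hrs, by rw [mul_comm, hrs]⟩) hr

theorem exists_isometric_mem_specialGenus [FiniteDimensional K V] (hK : finrank ℚ K = 2)
    [IsTotallyComplex K] (hd₃ : discr K ≠ -3) (hd₄ : discr K ≠ -4) (hconj : conj ≠ 1)
    {h : V →ₗ[K] V →ₛₗ[(conj : K →+* K)] K} (hh : IsHermitian h) (hn : Odd (finrank K V))
    {L N : Submodule (𝓞 K) V} (hL : IsUnimodular h L)
    (hN : N ∈ partialGenus h L (steinitzClass L)) :
    ∃ N' ∈ specialGenus h L, ∃ σ ∈ unitaryGroup h, (N' : Set V) = σ '' (N : Set V) := by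
  obtain ⟨hNg, hNs⟩ := hN
  let b := finBasis K V
  obtain ⟨d, hd⟩ := exists_detIdeal_eq_map_of_steinitzClass_eq hL.1 hNg.1 b hNs
  have hd1 : ∀ y ∈ detIdeal b L, (d : K) * y ∈ detIdeal b N := fun y hy => by
    rw [hd]
    exact ⟨y, hy, rfl⟩
  have hd2 : ∀ y ∈ detIdeal b N, ((d⁻¹ : Kˣ) : K) * y ∈ detIdeal b L := fun y hy => by
    rw [hd] at hy
    obtain ⟨z, hz, rfl⟩ := hy
    rw [LinearMap.mulLeft_apply, Units.inv_mul_cancel_left]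
    exact hz
  have hdn := mul_conj_eq_one_of_mem_genus hK hd₃ hd₄ hconj hL hNg b hd1 hd2
  obtain ⟨x, a, hxa⟩ := exists_pseudoBasis _ rfl hL.1
  have hvec : ∀ {p : ℕ}, p.Prime → ∃ v ∈ L, ∃ m : ℤ, (m : K) = h v v ∧ ¬ (p : ℤ) ∣ m :=
    fun hp => exists_norm_not_dvd hK hconj hh (by simpa using hn) hL.2 hxa hp
  -- Any prime would do: only `h v v ≠ 0` is needed for the global quasi-reflection.
  obtain ⟨v, hv, m, hm, hpm⟩ := hvec Nat.prime_two
  have hm0 : h v v ≠ 0 := by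
    rw [← hm]
    have : m ≠ 0 := by
      rintro rfl
      exact hpm (dvd_zero _)
    exact_mod_cast this
  obtain ⟨σ, hσ, hσdet, -⟩ := exists_quasiReflection h (fun w => hh v w)
    (inv_mul_cancel₀ hm0) d⁻¹ (by
      have h1 : (((d⁻¹ : Kˣ) : K) * conj ((d⁻¹ : Kˣ) : K)) * ((d : K) * conj d) = 1 := by
        rw [mul_mul_mul_comm, ← map_mul, Units.inv_mul, map_one, one_mul]
      rwa [hdn, mul_one] at h1)
  refine ⟨N.map ((σ : V →ₗ[K] V).restrictScalars (𝓞 K)), ⟨isLattice_map hNg.1 σ, ?_⟩, σ, hσ, rfl⟩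
  intro p hp
  obtain ⟨ρ, hρ, hNρ⟩ := hNg.2 p
  obtain ⟨v, hv, m, hm, hpm⟩ := hvec hp.out
  -- Chosen so that `d⁻¹ * det ρ * u = 1`: the three factors are the determinants of the global
  -- correction `σ`, of `ρ`, and of an automorphism `π` of `L_p`.
  let u : (LocalAlg K p)ˣ := (LinearEquiv.det ρ)⁻¹ *
    Units.map (algebraMap K (LocalAlg K p) : K →* LocalAlg K p) d
  have hu : (u : LocalAlg K p) ∈ localInt K p := inv_det_mul_mem_localInt b hL.1 hNρ hd1
  have hu' : ((u⁻¹ : (LocalAlg K p)ˣ) : LocalAlg K p) ∈ localInt K p := by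
    have h1 := inv_det_mul_mem_localInt b hNg.1 (ρ.eq_symm_image_of_eq_image hNρ) hd2
    have h2 : (LinearEquiv.det ρ.symm)⁻¹ = LinearEquiv.det ρ := by
      change (LinearEquiv.det ρ⁻¹)⁻¹ = _
      rw [map_inv, inv_inv]
    rw [h2] at h1
    have h3 : u⁻¹ = LinearEquiv.det ρ *
        Units.map (algebraMap K (LocalAlg K p) : K →* LocalAlg K p) d⁻¹ := by
      simp only [u, mul_inv, inv_inv, map_inv]
    rw [h3]
    exact h1
  have hun : (u : LocalAlg K p) * localConj p conj u = 1 := by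
    have h1 := det_mul_map_det_eq_one _ _ (isUnit_det_gram_localForm (p := p) hL b) (inv_mem hρ)
    rw [map_inv] at h1
    have h2 : algebraMap K (LocalAlg K p) (d : K) *
        localConj p conj (algebraMap K (LocalAlg K p) (d : K)) = 1 := by
      rw [localConj_algebraMap, ← map_mul]
      change algebraMap K (LocalAlg K p) ((d : K) * conj d) = 1
      rw [hdn, map_one]
    change _ * algebraMap K (LocalAlg K p) (d : K) *
      localConj p conj (_ * algebraMap K (LocalAlg K p) (d : K)) = 1
    rw [map_mul, mul_mul_mul_comm, h1, h2, one_mul]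
  obtain ⟨π, hπ, hπdet, hπL⟩ := exists_local_automorphism_det hh hL.2 hv hm hpm u hu hu' hun
  refine ⟨σ.baseChange K (LocalAlg K p) V V * ρ * π, ⟨mul_mem (mul_mem
    (baseChange_mem_unitaryGroup hσ) hρ) hπ, ?_⟩, ?_⟩
  · change LinearEquiv.det _ = 1
    rw [map_mul, map_mul, hπdet, LinearEquiv.det_baseChange, hσdet, map_inv]
    simp only [u]
    change (Units.map (algebraMap K (LocalAlg K p) : K →* LocalAlg K p) d)⁻¹ * _ * _ = 1
    rw [mul_assoc, mul_inv_cancel_left, inv_mul_cancel]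
  · rw [localLattice_image (σ := σ) (L := N) rfl, hNρ]
    nth_rewrite 1 [hπL]
    rw [Set.image_image, Set.image_image]
    rfl

theorem exists_special_isometry_of_mem_specialGenus [FiniteDimensional K V]
    (hK : finrank ℚ K = 2) [IsTotallyComplex K] (hd₃ : discr K ≠ -3) (hd₄ : discr K ≠ -4)
    {h : V →ₗ[K] V →ₛₗ[(conj : K →+* K)] K} (hn : Odd (finrank K V))
    {L N N' : Submodule (𝓞 K) V} (hL : L.IsLattice K) (hN : N ∈ specialGenus h L)
    (hN' : N' ∈ specialGenus h L) (hiso : N' ∈ cls h N) : N' ∈ specialCls h N := by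
  obtain ⟨σ, hσ, hσN⟩ := hiso
  refine exists_special_image_eq hn hσ ?_ hσN
  let b := finBasis K V
  have h1 := detIdeal_image b hσN
  rw [detIdeal_eq_of_mem_specialGenus b hL hN', detIdeal_eq_of_mem_specialGenus b hL hN] at h1
  obtain ⟨I, hI, -⟩ := exists_eq_detIdeal hL b
  rw [hI] at h1
  obtain ⟨u, hu⟩ := exists_unit_eq_of_map_eq h1.symm
  rcases unit_eq_one_or_neg_one hK hd₃ hd₄ u with rfl | rfl
  · left
    ext
    rw [← hu]
    simp
  · right
    ext
    rw [← hu]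
    simp

end Global

end HermLat

end

theorem corollary1 {K : Type*} [Field K] [NumberField K]
    (hK : Module.finrank ℚ K = 2) [NumberField.IsTotallyComplex K]
    (hd₃ : NumberField.discr K ≠ -3) (hd₄ : NumberField.discr K ≠ -4)
    (conj : K ≃ₐ[ℚ] K) (hconj : conj ≠ AlgEquiv.refl)
    {V : Type*} [AddCommGroup V] [Module K V] [FiniteDimensional K V]
    [Module (NumberField.RingOfIntegers K) V] [IsScalarTower (NumberField.RingOfIntegers K) K V]
    (h : V →ₗ[K] V →ₛₗ[(conj : K →+* K)] K) (hh : HermLat.IsHermitian h)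
    (hn : Odd (Module.finrank K V))
    (L : Submodule (NumberField.RingOfIntegers K) V) (hL : HermLat.IsUnimodular h L) :
    HermLat.specialClassNumber h L =
      HermLat.partialClassNumber h L (HermLat.steinitzClass L) := by
  refine Cardinal.mk_image_eq_mk_image _ _ ?_ ?_ ?_
  -- The special genus is contained in the partial genus.
  · intro N hN
    refine ⟨⟨hN.1, fun p _ => ?_⟩, ?_⟩
    · obtain ⟨σ, hσ, hNσ⟩ := hN.2 p
      exact ⟨σ, hσ.1, hNσ⟩
    · exact HermLat.steinitzClass_eq_of_detIdeal_eq hL.1 hN.1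
        (HermLat.detIdeal_eq_of_mem_specialGenus (Module.finBasis K V) hL.1 hN)
  -- Every isometry class in the partial genus meets the special genus.
  · intro N hN
    obtain ⟨N', hN', σ, hσ, hσN⟩ :=
      HermLat.exists_isometric_mem_specialGenus hK hd₃ hd₄ hconj hh hn hL hN
    exact ⟨N', hN', HermLat.setOf_image_eq_of_image_eq hσ hσN⟩
  -- On the special genus, isometry and special isometry coincide.
  · intro N hN N' hN'
    constructor
    · intro heq
      have hmem : N ∈ HermLat.specialCls h N' := heq ▸ ⟨1, one_mem _, by simp⟩
      obtain ⟨σ, hσ, hσN⟩ := hmem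
      exact HermLat.setOf_image_eq_of_image_eq hσ.1 hσN
    · intro heq
      have hmem : N ∈ HermLat.cls h N' := heq ▸ ⟨1, one_mem _, by simp⟩
      obtain ⟨σ, hσ, hσN⟩ :=
        HermLat.exists_special_isometry_of_mem_specialGenus hK hd₃ hd₄ hn hL.1 hN' hN hmem
      exact HermLat.setOf_image_eq_of_image_eq hσ hσN
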